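/- Let $\Sigma=\{0,1\}$. Order $\Sigma^*$ by $\le_{\rm lex}$ (by length first, then lexicographically), and write $a\prec_{\rm lex} b$ if $b$ is the immediate successor of $a$ in this order. For a polynomial $p$, a nondeterministic polynomial-time Turing machine (NPTM) $M$ is \emph{$p$-balanced} if on each input $x$ the set of nondeterministic guess sequences along the computation paths of $M$ is precisely $\{0,1\}^{p(|x|)}$ (one path for each); each path is named by its guess sequence, and ${\rm acc}_M(x)\subseteq\{0,1\}^{p(|x|)}$ is the set of accepting paths. A function $f:\Sigma^*\to\mathbb{N}$ belongs to ${\rm CLU\#P}$ if there are a polynomial $p$, a $p$-balanced NPTM $M$, total polynomial-time computable functions $b,\top:\Sigma^*\to\Sigma^*$ and a 3-argument polynomial-time computable predicate $\prec$ such that for every $x\in\Sigma^*$, with $n=p(|x|)$, there is a bijection $h_x:\{0,1\}^n\to\{0,1\}^n$ with: (1) $|b(x)|=|\top(x)|=n$; (2) $h_x(b(x))=0^n$ and $h_x(\top(x))=1^n$; (3) for all $y,z\in\{0,1\}^n$: ${\prec}(x,y,z)\iff h_x(y)\prec_{\rm lex}h_x(z)$; (4) if $f(x)\ne 0$, then there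 are $\ell,u\in\{0,1\}^n$ with ${\rm acc}_M(x)=\{w\in\{0,1\}^n : h_x(\ell)\le_{\rm lex}h_x(w)\le_{\rm lex}h_x(u)\}$; (5) $f(x)=\|{\rm acc}_M(x)\|$. A function $f:\Sigma^*\to\mathbb{N}$ belongs to ${\rm CLU\#P}_{\rm circular}$, witnessed by $(p,M,\prec)$, if $p$ is a polynomial, $M$ is a $p$-balanced NPTM and $\prec$ is a 3-argument polynomial-time computable predicate such that for every $x\in\Sigma^*$, with $n=p(|x|)$, there is a bijection $h_x:\{0,1\}^n\to\{0,1\}^n$ for which (4) and (5) hold and, for all $y,z\in\{0,1\}^n$, $${\prec}(x,y,z)\iff \bigl(h_x(y)\prec_{\rm lex}h_x(z)\ \lor\ (h_x(y)=1^n\land h_x(z)=0^n)\bigr).$$ Let $\widetilde{\rm CLU\#P}_{\rm circular}$ be the class of all functions $f\in{\rm CLU\#P}_{\rm circular}$ whose membership is witnessed by some $(p,M,\prec)$ for which $\{x\in\Sigma^* : f(x)=2^{p(|x|)}\}\in{\rm P}$. Theorem. $\widetilde{\rm CLU\#P}_{\rm circular}={\rm CLU\#P}$. -/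

import Mathlib

namespace ClusterComputing

/-- Strings over the alphabet `{0,1}`: `false` is the symbol `0` and `true` is the symbol `1`. -/
abbrev Str : Type := List Bool

/-- `{0,1}^n`, the set of strings of length `n`. -/
def strs (n : ℕ) : Set Str := {w | w.length = n}

/-- The strict order on strings: by length first, then lexicographically. -/
def lexLT (a b : Str) : Prop := List.Shortlex (· < ·) a b

/-- The order `≤_lex`. -/
def lexLE (a b : Str) : Prop := a = b ∨ lexLT a b

/-- `a ≺_lex b`: the string `b` is the immediate successor of `a`. -/
def lexSucc (a b : Str) : Prop := lexLT a b ∧ ¬ ∃ c, lexLT a c ∧ lexLT c b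

/-! ### Deterministic polynomial time -/

/-- `FP_t`: the total functions from strings to strings that are computed by a deterministic
Turing machine in polynomial time. -/
def InFP (g : Str → Str) : Prop :=
  Nonempty (Turing.TM2ComputableInPolyTime (Computability.encodingList Bool).encode
    (Computability.encodingList Bool).encode g)

open Classical in
/-- `P`: the sets of strings decided by a deterministic Turing machine in polynomial time. -/
def InP (L : Set Str) : Prop :=
  Nonempty (Turing.TM2ComputableInPolyTime (Computability.encodingList Bool).encode
    Computability.encodeBool (fun x : Str => decide (x ∈ L)))

/-- The encoding of triples of strings as one input: the three strings are written one after the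
other, in three disjoint copies of the alphabet. -/
def encodeTriple : Str × Str × Str → List (Bool ⊕ Bool ⊕ Bool) :=
  (Computability.encodingProd (Computability.encodingList Bool)
    (Computability.encodingProd (Computability.encodingList Bool)
      (Computability.encodingList Bool))).encode

open Classical in
/-- The 3-argument predicates on strings that are computable in polynomial time. -/
def PolyTimePred₃ (R : Str → Str → Str → Prop) : Prop :=
  Nonempty (Turing.TM2ComputableInPolyTime encodeTriple Computability.encodeBool
    (fun t : Str × Str × Str => decide (R t.1 t.2.1 t.2.2)))

/-! ### Nondeterministic machines -/

/-- A nondeterministic Turing machine: a machine `tm` in which some labels are guessing labels.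
If `alt l = none`, the machine acts deterministically at the label `l`, by executing `tm.m l`.
If `alt l = some s`, it guesses one bit at `l` and executes `tm.m l` on the guess `0` and `s` on
the guess `1`. A halted machine accepts or rejects according to its internal state. -/
structure NTM where
  /-- the underlying machine -/
  tm : Turing.FinTM2
  /-- the input alphabet is `{0,1}` -/
  inputAlphabet : tm.Γ tm.k₀ ≃ Bool
  /-- the second alternative at the guessing labels -/
  alt : tm.Λ → Option tm.Stmt
  /-- the accepting internal states -/
  accept : tm.σ → Bool

namespace NTM

variable (N : NTM)

/-- The initial configuration on input `x`. -/
def init (x : Str) : N.tm.Cfg := Turing.initList N.tm (x.map N.inputAlphabet.symm)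

/-- The configuration reached from `c` by executing the statement `s`. -/
def exec (s : N.tm.Stmt) (c : N.tm.Cfg) : N.tm.Cfg := Turing.TM2.stepAux s c.var c.stk

/-- `N.Run c w t c'`: the machine can get from `c` to `c'` in exactly `t` steps, with `w` the
sequence of its nondeterministic guesses on the way. -/
inductive Run : N.tm.Cfg → Str → ℕ → N.tm.Cfg → Prop
  | refl (c : N.tm.Cfg) : Run c [] 0 c
  | det {c c' : N.tm.Cfg} {l : N.tm.Λ} {w : Str} {t : ℕ} (hl : c.l = some l)
      (ha : N.alt l = none) (h : Run (N.exec (N.tm.m l) c) w t c') : Run c w (t + 1) c'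
  | guess0 {c c' : N.tm.Cfg} {l : N.tm.Λ} {s : N.tm.Stmt} {w : Str} {t : ℕ} (hl : c.l = some l)
      (ha : N.alt l = some s) (h : Run (N.exec (N.tm.m l) c) w t c') :
      Run c (false :: w) (t + 1) c'
  | guess1 {c c' : N.tm.Cfg} {l : N.tm.Λ} {s : N.tm.Stmt} {w : Str} {t : ℕ} (hl : c.l = some l)
      (ha : N.alt l = some s) (h : Run (N.exec s c) w t c') : Run c (true :: w) (t + 1) c'

/-- The computation paths on input `x`, each named by its sequence of guesses. -/
def paths (x : Str) : Set Str :=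
  {w | ∃ (t : ℕ) (c : N.tm.Cfg), N.Run (N.init x) w t c ∧ c.l = none}

/-- The accepting computation paths on input `x`, each named by its sequence of guesses. -/
def acc (x : Str) : Set Str :=
  {w | ∃ (t : ℕ) (c : N.tm.Cfg), N.Run (N.init x) w t c ∧ c.l = none ∧ N.accept c.var = true}

/-- The machine runs in polynomial time: on no input `x` and for no guesses can it run for more
than `q(|x|)` steps. (As a configuration that has not halted always has a next one, every
computation then halts.) -/
def PolyTime : Prop :=
  ∃ q : Polynomial ℕ, ∀ (x w : Str) (t : ℕ) (c : N.tm.Cfg),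
    N.Run (N.init x) w t c → t ≤ q.eval x.length

/-- The machine is `p`-balanced: on each input `x`, the guess sequences of its computation paths
are precisely the strings of length `p(|x|)`. -/
def Balanced (p : Polynomial ℕ) : Prop := ∀ x : Str, N.paths x = strs (p.eval x.length)

end NTM

/-! ### The cluster classes -/

/-- The set `A` of strings of length `n` is an interval in the order that the numbering `h` of the
strings of length `n` induces. -/
def Clustered (n : ℕ) (h : Str → Str) (A : Set Str) : Prop :=
  ∃ l ∈ strs n, ∃ u ∈ strs n, A = {w | w ∈ strs n ∧ lexLE (h l) (h w) ∧ lexLE (h w) (h u)}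

/-- The class `CLU#P`. -/
def CLUSharpP : Set (Str → ℕ) :=
  {f | ∃ (p : Polynomial ℕ) (M : NTM) (b top : Str → Str) (prec : Str → Str → Str → Prop),
    M.PolyTime ∧ M.Balanced p ∧ InFP b ∧ InFP top ∧ PolyTimePred₃ prec ∧
    ∀ x : Str, ∃ h : Str → Str,
      Set.BijOn h (strs (p.eval x.length)) (strs (p.eval x.length)) ∧
      (b x).length = p.eval x.length ∧ (top x).length = p.eval x.length ∧
      h (b x) = List.replicate (p.eval x.length) false ∧
      h (top x) = List.replicate (p.eval x.length) true ∧
      (∀ y ∈ strs (p.eval x.length), ∀ z ∈ strs (p.eval x.length),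
        (prec x y z ↔ lexSucc (h y) (h z))) ∧
      (f x ≠ 0 → Clustered (p.eval x.length) h (M.acc x)) ∧
      f x = (M.acc x).ncard}

/-- The polynomial `p`, the machine `M` and the predicate `prec` witness that `f` belongs to
`CLU#P_circular`. -/
def CircularWitness (p : Polynomial ℕ) (M : NTM) (prec : Str → Str → Str → Prop)
    (f : Str → ℕ) : Prop :=
  M.PolyTime ∧ M.Balanced p ∧ PolyTimePred₃ prec ∧
  ∀ x : Str, ∃ h : Str → Str,
    Set.BijOn h (strs (p.eval x.length)) (strs (p.eval x.length)) ∧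
    (∀ y ∈ strs (p.eval x.length), ∀ z ∈ strs (p.eval x.length),
      (prec x y z ↔ (lexSucc (h y) (h z) ∨
        (h y = List.replicate (p.eval x.length) true ∧
          h z = List.replicate (p.eval x.length) false)))) ∧
    (f x ≠ 0 → Clustered (p.eval x.length) h (M.acc x)) ∧
    f x = (M.acc x).ncard

/-- The class `CLU#P_circular`. -/
def CLUSharpPCircular : Set (Str → ℕ) := {f | ∃ p M prec, CircularWitness p M prec f}

/-- The class of those functions `f` in `CLU#P_circular` for which some witness `p`, `M`, `prec`
is such that the set of the inputs `x` with `f(x) = 2^{p(|x|)}` is in `P`. -/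
def TildeCLUSharpPCircular : Set (Str → ℕ) :=
  {f | ∃ p M prec, CircularWitness p M prec f ∧ InP {x | f x = 2 ^ (p.eval x.length)}}

end ClusterComputing

/-! One inclusion is direct. To pass from `CLU#P` to the circular class, add the pair (`top x`, `b
x`) to the successor predicate. The accepting set is an interval, so it is everything as soon as it
contains both ends; hence `f x = 2^n` is tested by simulating the two paths `b x` and `top x`
(`CLUSharpP_subset`).

For the converse, the strings of length `n` form a cycle of length `N = 2^n`, on which the accepting
set `A` is an arc. The cycle has to be opened at a computable place without splitting `A`. The
string `zero = 0^n` is computable, but it may lie inside `A`. The end of `A` is easy to recognize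
(`u ∈ A`, its successor `v ∉ A`), but there is no evident way to compute it. The way out is to let a
path start and end at copies of `zero` and to cut, somewhere along it, at the end of `A`. Number the
cycle from `zero`. Let `c` be the number of the last element of `A` if `zero ∈ A` and `A` is not
everything, and `N - 1` otherwise. Take four copies of the cycle, tagged by two bits, and let the
path run through 01: `0..c`; 00: `c+1..N-1, 0..c`; 11: `c+1..N-1, 0..c`; 01: `c+1..N-1`; 10:
`N-1..0`. Copy 00 is passed without interruption and is cut exactly behind `c`, so that `A`, placed
in this copy, is an interval of the path. Copy 01 leads from `zero` to the unknown cut, and its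
remainder is collected later; the reversed copy 10 leads back to `zero`; copy 11 makes the number of
copies a power of two. Each edge is recognized from its two ends, since the cut edge is either the
edge leaving `A` or the edge into `zero`. Choosing between these two cases needs to know whether `A`
is everything, for then no edge leaves `A`. This is where the hypothesis that `f x = 2^n` is
decidable in P enters. See `tagNext_iff`, `exists_cut` and `exists_path`. The tags are two
additional guesses, which must both be `0` for acceptance (`NTM.pad`), so the number of accepting
paths does not change.

The rest is about machines: a small calculus of stack programs gives the closure properties of
polynomial time (`PolyFn`), and a single path of a nondeterministic machine is simulated
deterministically (`NTM.exists_simulation`). Run without guesses, the simulator produces `0^n`, so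
that no machine has to evaluate the polynomial `p`. -/

namespace ClusterComputing

open Turing Function

/-! ### Runs of multi-stack programs -/

section Programs

variable {K : Type} [DecidableEq K] {Γ : K → Type} {Λ σ : Type}

/-- `StepsTo M t c c'`: the program `M` gets from `c` to `c'` in exactly `t` steps. -/
inductive StepsTo (M : Λ → TM2.Stmt Γ Λ σ) : ℕ → TM2.Cfg Γ Λ σ → TM2.Cfg Γ Λ σ → Prop
  | refl (c : TM2.Cfg Γ Λ σ) : StepsTo M 0 c c
  | step {t : ℕ} {l : Λ} {v : σ} {S : ∀ k, List (Γ k)} {c : TM2.Cfg Γ Λ σ}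
      (h : StepsTo M t (TM2.stepAux (M l) v S) c) : StepsTo M (t + 1) ⟨some l, v, S⟩ c

theorem StepsTo.trans {M : Λ → TM2.Stmt Γ Λ σ} {t t' : ℕ} {a b c : TM2.Cfg Γ Λ σ}
    (h : StepsTo M t a b) (h' : StepsTo M t' b c) : StepsTo M (t + t') a c := by
  induction h with
  | refl => simpa using h'
  | step _ ih => rw [Nat.add_right_comm]; exact .step (ih h')

theorem StepsTo.iterate {M : Λ → TM2.Stmt Γ Λ σ} {t : ℕ} {a b : TM2.Cfg Γ Λ σ}
    (h : StepsTo M t a b) : (flip bind (TM2.step M))^[t] (some a) = some b := by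
  induction h with
  | refl => rfl
  | step _ ih => rw [iterate_succ_apply]; exact ih

theorem StepsTo.of_iterate {M : Λ → TM2.Stmt Γ Λ σ} {t : ℕ} {a b : TM2.Cfg Γ Λ σ}
    (h : (flip bind (TM2.step M))^[t] (some a) = some b) : StepsTo M t a b := by
  induction t generalizing a with
  | zero => obtain rfl : a = b := by simpa using h
            exact .refl a
  | succ t ih =>
    rw [iterate_succ_apply] at h
    rcases a with ⟨_ | l, v, S⟩
    · exfalso
      -- A halted configuration has no successor, so the iteration stays at `none`.
      have : ∀ t, (flip bind (TM2.step M))^[t] (none : Option (TM2.Cfg Γ Λ σ)) = none := by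
        intro t
        induction t with
        | zero => rfl
        | succ t ih => rw [iterate_succ_apply]; exact ih
      have h' : (flip bind (TM2.step M))^[t] (none : Option (TM2.Cfg Γ Λ σ)) = some b := h
      rw [this] at h'
      cases h'
    · exact .step (ih h)

/-- A bound on the number of symbols that a statement pushes on a stack. -/
def pushes : TM2.Stmt Γ Λ σ → ℕ
  | .push _ _ q => pushes q + 1
  | .peek _ _ q => pushes q
  | .pop _ _ q => pushes q
  | .load _ q => pushes q
  | .branch _ q₁ q₂ => pushes q₁ + pushes q₂
  | .goto _ => 0
  | .halt => 0

theorem length_stepAux_le (q : TM2.Stmt Γ Λ σ) (v : σ) (S : ∀ k, List (Γ k)) (k : K) :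
    ((TM2.stepAux q v S).stk k).length ≤ (S k).length + pushes q := by
  induction q generalizing v S with
  | push j f q ih =>
    refine (ih _ _).trans ?_
    by_cases h : k = j
    · subst h; simp [pushes]; omega
    · simp [h, pushes]
  | peek j f q ih => exact ih _ _
  | pop j f q ih =>
    refine (ih _ _).trans ?_
    by_cases h : k = j
    · subst h; simp [pushes]
    · simp [h, pushes]
  | load f q ih => exact ih _ _
  | branch f q₁ q₂ ih₁ ih₂ =>
    simp only [TM2.stepAux, pushes]
    cases f v
    · exact (ih₂ _ _).trans (by omega)
    · exact (ih₁ _ _).trans (by omega)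
  | goto f => simp
  | halt => simp

/-- One step pushes at most `C` symbols on a stack. This makes the output length polynomial in the
input length, which is needed to bound the time of a program that runs afterwards. -/
theorem StepsTo.length_le {M : Λ → TM2.Stmt Γ Λ σ} {C t : ℕ} (hC : ∀ l, pushes (M l) ≤ C)
    {a b : TM2.Cfg Γ Λ σ} (h : StepsTo M t a b) (k : K) :
    (b.stk k).length ≤ (a.stk k).length + C * t := by
  induction h with
  | refl => simp
  | @step t l v S c _ ih =>
    have := length_stepAux_le (M l) v S k
    have := hC l
    simp only [Nat.mul_succ] at *
    omega

omit [DecidableEq K] in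
theorem exists_pushes_le [Finite Λ] (M : Λ → TM2.Stmt Γ Λ σ) : ∃ C, ∀ l, pushes (M l) ≤ C := by
  obtain ⟨C, hC⟩ := (Set.finite_range fun l => pushes (M l)).bddAbove
  exact ⟨C, fun l => hC ⟨l, rfl⟩⟩

/-! ### Translating statements into a larger machine -/

/-- The translation of a statement into a machine with more stacks, labels and states: the stacks
are renamed by `ι`, the labels by `fl`, the state is accessed through `g` and `p`, and halting is
replaced by the statement `q₀`. -/
def tr {K' Λ' σ' : Type} {Γ' : K' → Type} (ι : K → K') (g : σ' → σ) (p : σ → σ' → σ')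
    (fl : Λ → Λ') (q₀ : TM2.Stmt Γ' Λ' σ') :
    TM2.Stmt (fun k => Γ' (ι k)) Λ σ → TM2.Stmt Γ' Λ' σ'
  | .push k f q => .push (ι k) (fun s => f (g s)) (tr ι g p fl q₀ q)
  | .peek k f q => .peek (ι k) (fun s o => p (f (g s) o) s) (tr ι g p fl q₀ q)
  | .pop k f q => .pop (ι k) (fun s o => p (f (g s) o) s) (tr ι g p fl q₀ q)
  | .load f q => .load (fun s => p (f (g s)) s) (tr ι g p fl q₀ q)
  | .branch f q₁ q₂ => .branch (fun s => f (g s)) (tr ι g p fl q₀ q₁) (tr ι g p fl q₀ q₂)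
  | .goto f => .goto (fun s => fl (f (g s)))
  | .halt => q₀

/-- The conditions on `g` and `p` say that the small state is a component of the large one, read by
`g` and overwritten by `p`. As `ι` is injective, updates of the renamed stacks do not interfere, and
all other stacks are untouched. -/
theorem stepAux_tr {K' Λ' σ' : Type} [DecidableEq K'] {Γ' : K' → Type} {ι : K → K'}
    (hι : Injective ι) {g : σ' → σ} {p : σ → σ' → σ'} (hgp : ∀ a s, g (p a s) = a)
    (hpp : ∀ a b s, p a (p b s) = p a s) (hpg : ∀ s, p (g s) s = s)
    (fl : Λ → Λ') (q₀ : TM2.Stmt Γ' Λ' σ')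
    (q : TM2.Stmt (fun k => Γ' (ι k)) Λ σ) (v' : σ') (S' : ∀ k, List (Γ' k)) :
    ∃ T : ∀ k, List (Γ' k),
      (fun k => T (ι k)) = (TM2.stepAux q (g v') (fun k => S' (ι k))).stk ∧
      (∀ k, k ∉ Set.range ι → T k = S' k) ∧
      TM2.stepAux (tr ι g p fl q₀ q) v' S' =
        match (TM2.stepAux q (g v') (fun k => S' (ι k))).l with
        | some l => ⟨some (fl l), p (TM2.stepAux q (g v') (fun k => S' (ι k))).var v', T⟩
        | none => TM2.stepAux q₀ (p (TM2.stepAux q (g v') (fun k => S' (ι k))).var v') T := by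
  induction q generalizing v' S' with
  | push k f q ih =>
    obtain ⟨T, h1, h2, h3⟩ := ih v' (update S' (ι k) (f (g v') :: S' (ι k)))
    have e := update_comp_eq_of_injective' S' hι k (f (g v') :: S' (ι k))
    rw [e] at h1 h3
    refine ⟨T, h1, fun j hj => ?_, h3⟩
    rw [h2 j hj, update_of_ne]
    rintro rfl
    exact hj ⟨k, rfl⟩
  | peek k f q ih =>
    obtain ⟨T, h1, h2, h3⟩ := ih (p (f (g v') (S' (ι k)).head?) v') S'
    simp only [hgp, hpp] at h1 h3
    exact ⟨T, h1, h2, h3⟩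
  | pop k f q ih =>
    obtain ⟨T, h1, h2, h3⟩ := ih (p (f (g v') (S' (ι k)).head?) v')
      (update S' (ι k) (S' (ι k)).tail)
    have e := update_comp_eq_of_injective' S' hι k (S' (ι k)).tail
    rw [e] at h1 h3
    simp only [hgp, hpp] at h1 h3
    refine ⟨T, h1, fun j hj => ?_, h3⟩
    rw [h2 j hj, update_of_ne]
    rintro rfl
    exact hj ⟨k, rfl⟩
  | load f q ih =>
    obtain ⟨T, h1, h2, h3⟩ := ih (p (f (g v')) v') S'
    simp only [hgp, hpp] at h1 h3
    exact ⟨T, h1, h2, h3⟩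
  | branch f q₁ q₂ ih₁ ih₂ =>
    simp only [TM2.stepAux, tr]
    cases f (g v')
    · exact ih₂ v' S'
    · exact ih₁ v' S'
  | goto f => exact ⟨S', rfl, fun _ _ => rfl, by simp [tr, hpg]⟩
  | halt => exact ⟨S', rfl, fun _ _ => rfl, by simp [tr, hpg]⟩

theorem exists_stepAux_tr {K' Λ' σ' : Type} [DecidableEq K'] {Γ' : K' → Type} {ι : K → K'}
    (hι : Injective ι) {g : σ' → σ} {p : σ → σ' → σ'} (hgp : ∀ a s, g (p a s) = a)
    (hpp : ∀ a b s, p a (p b s) = p a s) (hpg : ∀ s, p (g s) s = s)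
    (fl : Λ → Λ') (q₀ : TM2.Stmt Γ' Λ' σ')
    (q : TM2.Stmt (fun k => Γ' (ι k)) Λ σ) (v' : σ') (S' : ∀ k, List (Γ' k))
    {c : TM2.Cfg (fun k => Γ' (ι k)) Λ σ}
    (hc : TM2.stepAux q (g v') (fun k => S' (ι k)) = c) :
    ∃ T : ∀ k, List (Γ' k), (fun k => T (ι k)) = c.stk ∧ (∀ k, k ∉ Set.range ι → T k = S' k) ∧
      TM2.stepAux (tr ι g p fl q₀ q) v' S' =
        match c.l with
        | some l => ⟨some (fl l), p c.var v', T⟩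
        | none => TM2.stepAux q₀ (p c.var v') T := by
  subst hc
  exact stepAux_tr hι hgp hpp hpg fl q₀ q v' S'

/-- The translated run is stopped just before its last step, because that step executes `q₀` where
the original halts. Each use chooses its own `q₀` (go on with another program, reset the state,
halt) and completes the run. -/
theorem StepsTo.map {K' Λ' σ' : Type} [DecidableEq K'] {Γ' : K' → Type} {ι : K → K'}
    (hι : Injective ι) {g : σ' → σ} {p : σ → σ' → σ'} (hgp : ∀ a s, g (p a s) = a)
    (hpp : ∀ a b s, p a (p b s) = p a s) (hpg : ∀ s, p (g s) s = s)
    {fl : Λ → Λ'} {q₀ : TM2.Stmt Γ' Λ' σ'}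
    {M : Λ → TM2.Stmt (fun k => Γ' (ι k)) Λ σ} {M' : Λ' → TM2.Stmt Γ' Λ' σ'}
    (hM : ∀ l, M' (fl l) = tr ι g p fl q₀ (M l)) {t : ℕ} {l : Λ} {v' : σ'} {w : σ}
    {S' T : ∀ k, List (Γ' k)}
    (h : StepsTo M t ⟨some l, g v', fun k => S' (ι k)⟩ ⟨none, w, fun k => T (ι k)⟩)
    (hT : ∀ k, k ∉ Set.range ι → T k = S' k) :
    ∃ t', t = t' + 1 ∧ ∃ l₁ v₁ S₁, StepsTo M' t' ⟨some (fl l), v', S'⟩ ⟨some l₁, v₁, S₁⟩ ∧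
      TM2.stepAux (M' l₁) v₁ S₁ = TM2.stepAux q₀ (p w v') T := by
  generalize ha : (⟨some l, g v', fun k => S' (ι k)⟩ : TM2.Cfg _ Λ σ) = a at h
  generalize hb : (⟨none, w, fun k => T (ι k)⟩ : TM2.Cfg _ Λ σ) = b at h
  induction h generalizing l v' S' with
  | refl => subst ha; cases hb
  | @step t l' v S c h ih =>
    cases ha
    subst hb
    obtain ⟨T', h1, h2, h3⟩ := stepAux_tr hι hgp hpp hpg fl q₀ (M l') v' S'
    rw [← hM] at h3
    generalize hc : TM2.stepAux (M l') (g v') (fun k => S' (ι k)) = c at h h1 h3 ih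
    rcases c with ⟨_ | l₁, v₁, S₁⟩
    · simp only at h1 h3
      cases h
      have : T' = T := by
        funext k
        by_cases hk : k ∈ Set.range ι
        · obtain ⟨j, rfl⟩ := hk
          exact congrFun h1 j
        · rw [h2 k hk, hT k hk]
      subst this
      exact ⟨0, rfl, fl l', v', S', .refl _, h3⟩
    · simp only at h1 h3
      subst h1
      obtain ⟨t', rfl, l₂, v₂, S₂, h4, h5⟩ := ih (l := l₁) (v' := p v₁ v') (S' := T')
        (fun k hk => by rw [hT k hk, h2 k hk]) (by rw [hgp]) rfl
      refine ⟨t' + 1, rfl, l₂, v₂, S₂, .step (h3 ▸ h4), ?_⟩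
      rw [h5, hpp]

end Programs

end ClusterComputing

namespace ClusterComputing

open Turing Function

/-! ### Program fragments -/

/-- The output of a transducer. -/
def transduce {A B Q : Type} (δ : Q → A → Q) (out : Q → Option B) : Q → List A → List B
  | _, [] => []
  | s, a :: l => (out (δ s a)).toList ++ transduce δ out (δ s a) l

theorem transduce_none {A B Q : Type} (δ : Q → A → Q) (s : Q) (l : List A) :
    transduce δ (fun _ => (none : Option B)) s l = [] := by
  induction l generalizing s with
  | nil => rfl
  | cons a l ih => simp [transduce, ih]

/-- The stacks that hold `l` at `k` and are empty elsewhere. -/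
def single {K : Type} [DecidableEq K] {Γ : K → Type} (k : K) (l : List (Γ k)) :
    ∀ k, List (Γ k) :=
  update (fun _ => []) k l

/-- A program on the stacks `Γ`, with private labels and states. -/
structure Prog (K : Type) (Γ : K → Type) where
  /-- labels -/
  Λ : Type
  /-- states -/
  σ : Type
  [finΛ : Fintype Λ]
  [finσ : Fintype σ]
  /-- the first label -/
  main : Λ
  /-- the first state -/
  init : σ
  /-- the code -/
  m : Λ → TM2.Stmt Γ Λ σ

attribute [instance] Prog.finΛ Prog.finσ FinTM2.kFin FinTM2.ΛFin FinTM2.σFin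

namespace Prog

variable {K : Type} [DecidableEq K] {Γ : K → Type}

/-- Started on the stacks `S`, the program halts within `T` steps with the stacks `S'`. -/
def Runs (F : Prog K Γ) (S : ∀ k, List (Γ k)) (T : ℕ) (S' : ∀ k, List (Γ k)) : Prop :=
  ∃ t ≤ T, ∃ v, StepsTo F.m t ⟨some F.main, F.init, S⟩ ⟨none, v, S'⟩

theorem Runs.mono {F : Prog K Γ} {S S' : ∀ k, List (Γ k)} {T T' : ℕ} (h : F.Runs S T S')
    (hT : T ≤ T') : F.Runs S T' S' :=
  let ⟨t, ht, v, hv⟩ := h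
  ⟨t, ht.trans hT, v, hv⟩

theorem Runs.length_le {F : Prog K Γ} {C : ℕ} (hC : ∀ l, pushes (F.m l) ≤ C)
    {S S' : ∀ k, List (Γ k)} {T : ℕ} (h : F.Runs S T S') (k : K) :
    (S' k).length ≤ (S k).length + C * T := by
  obtain ⟨t, ht, v, hv⟩ := h
  exact (hv.length_le hC k).trans (Nat.add_le_add_left (Nat.mul_le_mul_left _ ht) _)

/-- Sequential composition. -/
def seq (F G : Prog K Γ) : Prog K Γ where
  Λ := F.Λ ⊕ G.Λ
  σ := F.σ × G.σ
  main := .inl F.main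
  init := (F.init, G.init)
  m
    | .inl l => tr (Γ' := Γ) id Prod.fst (fun a s => (a, s.2)) .inl
        (.goto fun _ => .inr G.main) (F.m l)
    | .inr l => tr (Γ' := Γ) id Prod.snd (fun a s => (s.1, a)) .inr .halt (G.m l)

theorem Runs.seq {F G : Prog K Γ} {S S' S'' : ∀ k, List (Γ k)} {T T' : ℕ} (h : F.Runs S T S')
    (h' : G.Runs S' T' S'') : (F.seq G).Runs S (T + T') S'' := by
  obtain ⟨t, ht, v, hv⟩ := h
  obtain ⟨t', ht', v', hv'⟩ := h'
  obtain ⟨s, rfl, l₁, v₁, S₁, h1, h2⟩ := StepsTo.map (Γ' := Γ) (ι := id) injective_id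
    (g := Prod.fst) (p := fun a s => (a, s.2)) (fun _ _ => rfl) (fun _ _ _ => rfl)
    (fun _ => rfl) (M := F.m) (M' := (F.seq G).m) (fl := Sum.inl)
    (q₀ := (.goto fun _ => .inr G.main)) (fun _ => rfl) (v' := (F.init, G.init)) hv
    (fun k hk => (hk ⟨k, rfl⟩).elim)
  obtain ⟨s', rfl, l₂, v₂, S₂, h3, h4⟩ := StepsTo.map (Γ' := Γ) (ι := id) injective_id
    (g := Prod.snd) (p := fun a s => (s.1, a)) (fun _ _ => rfl) (fun _ _ _ => rfl)
    (fun _ => rfl) (M := G.m) (M' := (F.seq G).m) (fl := Sum.inr)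
    (q₀ := .halt) (fun _ => rfl) (v' := (v, G.init)) hv'
    (fun k hk => (hk ⟨k, rfl⟩).elim)
  refine ⟨s + (s' + 1 + 1), by omega, (v, v'), h1.trans (.step ?_)⟩
  rw [h2]
  refine h3.trans (.step ?_)
  rw [h4]
  exact .refl _

/-- The program that executes `F` on the stacks in the image of `ι`. -/
def lift {K' : Type} {Γ' : K' → Type} (ι : K → K') (F : Prog K (fun k => Γ' (ι k))) :
    Prog K' Γ' where
  Λ := F.Λ
  σ := F.σ
  main := F.main
  init := F.init
  m l := tr (Γ' := Γ') ι id (fun a _ => a) id .halt (F.m l)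

theorem Runs.lift {K' : Type} [DecidableEq K'] {Γ' : K' → Type} {ι : K → K'}
    (hι : Injective ι) {F : Prog K (fun k => Γ' (ι k))} {S S' : ∀ k, List (Γ' k)} {T : ℕ}
    (h : F.Runs (fun k => S (ι k)) T (fun k => S' (ι k)))
    (hS : ∀ k, k ∉ Set.range ι → S' k = S k) : (F.lift ι).Runs S T S' := by
  obtain ⟨t, ht, v, hv⟩ := h
  obtain ⟨s, rfl, l₁, v₁, S₁, h1, h2⟩ := StepsTo.map (Γ' := Γ') hι
    (g := id) (p := fun a _ => a) (fun _ _ => rfl) (fun _ _ _ => rfl)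
    (fun _ => rfl) (M := F.m) (M' := (F.lift ι).m) (fl := id)
    (q₀ := .halt) (fun _ => rfl) (v' := F.init) hv hS
  refine ⟨s + 1, ht, v, h1.trans (.step ?_)⟩
  rw [h2]
  exact .refl _

/-- The program of a machine. -/
def ofTM (tm : FinTM2) : Prog tm.K tm.Γ where
  Λ := tm.Λ
  σ := tm.σ
  main := tm.main
  init := tm.initialState
  m := tm.m

omit [DecidableEq K] in
theorem initList_eq (tm : FinTM2) (l : List (tm.Γ tm.k₀)) :
    initList tm l = ⟨some tm.main, tm.initialState, single tm.k₀ l⟩ := by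
  unfold initList single
  congr 1
  funext k
  by_cases h : k = tm.k₀
  · subst h; simp
  · simp [h]

omit [DecidableEq K] in
theorem haltList_eq (tm : FinTM2) (l : List (tm.Γ tm.k₁)) :
    haltList tm l = ⟨none, tm.initialState, single tm.k₁ l⟩ := by
  unfold haltList single
  congr 1
  funext k
  by_cases h : k = tm.k₁
  · subst h; simp
  · simp [h]

theorem runs_ofTM {tm : FinTM2} {l : List (tm.Γ tm.k₀)} {l' : List (tm.Γ tm.k₁)} {T : ℕ}
    (h : TM2OutputsInTime tm l (some l') T) :
    (ofTM tm).Runs (single tm.k₀ l) T (single tm.k₁ l') := by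
  obtain ⟨⟨t, e⟩, ht⟩ := h
  refine ⟨t, ht, tm.initialState, StepsTo.of_iterate ?_⟩
  rw [initList_eq] at e
  simp only [Option.map_some, haltList_eq] at e
  exact e

/-- The machine that executes a program and resets its state at the end. -/
def toTM [Fintype K] (F : Prog K Γ) (k₀ k₁ : K) [Fintype (Γ k₀)] : FinTM2 where
  K := K
  k₀ := k₀
  k₁ := k₁
  Γ := Γ
  Λ := F.Λ
  main := F.main
  σ := F.σ
  initialState := F.init
  m l := tr (Γ' := Γ) id id (fun a _ => a) id (.load (fun _ => F.init) .halt) (F.m l)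

/-- A machine outputs a word only if it halts in its initial state with all stacks but the output
stack empty. The first is achieved by the reset in `toTM`, which costs no extra step; the second is
why the final stacks have to be `single`. -/
theorem Runs.outputs [Fintype K] {F : Prog K Γ} {k₀ k₁ : K} [Fintype (Γ k₀)]
    {l : List (Γ k₀)} {l' : List (Γ k₁)} {T : ℕ} (h : F.Runs (single k₀ l) T (single k₁ l')) :
    Nonempty (TM2OutputsInTime (F.toTM k₀ k₁) l (some l') T) := by
  obtain ⟨t, ht, v, hv⟩ := h
  obtain ⟨s, rfl, l₁, v₁, S₁, h1, h2⟩ := StepsTo.map (Γ' := Γ) (ι := id) injective_id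
    (g := id) (p := fun a _ => a) (fun _ _ => rfl) (fun _ _ _ => rfl)
    (fun _ => rfl) (M := F.m) (M' := (F.toTM k₀ k₁).m) (fl := id)
    (q₀ := (.load (fun _ => F.init) .halt)) (fun _ => rfl) (v' := F.init) hv
    (fun k hk => (hk ⟨k, rfl⟩).elim)
  have h3 : StepsTo (F.toTM k₀ k₁).m (s + 1) ⟨some F.main, F.init, single k₀ l⟩
      ⟨none, F.init, single k₁ l'⟩ := by
    refine h1.trans (.step ?_)
    rw [h2]
    exact .refl _
  have e := h3.iterate
  have e₀ := initList_eq (F.toTM k₀ k₁) l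
  have e₁ := haltList_eq (F.toTM k₀ k₁) l'
  exact ⟨⟨⟨s + 1, (congrArg (fun c => (flip bind (F.toTM k₀ k₁).step)^[s + 1] (some c)) e₀).trans
    (e.trans (congrArg some e₁.symm))⟩, ht⟩⟩

/-! ### Basic programs -/

open Classical in
/-- Push a symbol, or nothing, on the stack `k`. -/
noncomputable def pushOpt {Λ σ : Type} (k : K) (f : σ → Option (Γ k)) (q : TM2.Stmt Γ Λ σ) :
    TM2.Stmt Γ Λ σ :=
  if h : Nonempty (Γ k) then
    .branch (fun s => (f s).isSome) (.push k (fun s => (f s).getD (Classical.choice h)) q) q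
  else q

theorem stepAux_pushOpt {Λ σ : Type} (k : K) (f : σ → Option (Γ k)) (q : TM2.Stmt Γ Λ σ) (v : σ)
    (S : ∀ k, List (Γ k)) :
    TM2.stepAux (pushOpt k f q) v S = TM2.stepAux q v (update S k ((f v).toList ++ S k)) := by
  unfold pushOpt
  split_ifs with h
  · rcases e : f v with _ | a <;> simp [e]
  · rcases e : f v with _ | a
    · simp
    · exact (h ⟨a⟩).elim

/-- Push a symbol, or nothing, on each of the stacks in the list. -/
noncomputable def pushAll {Λ σ : Type} (f : ∀ k, σ → Option (Γ k)) (q : TM2.Stmt Γ Λ σ) :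
    List K → TM2.Stmt Γ Λ σ
  | [] => q
  | k :: ks => pushOpt k (f k) (pushAll f q ks)

theorem stepAux_pushAll {Λ σ : Type} (f : ∀ k, σ → Option (Γ k)) (q : TM2.Stmt Γ Λ σ) (v : σ)
    (ks : List K) (hks : ks.Nodup) (S : ∀ k, List (Γ k)) :
    TM2.stepAux (pushAll f q ks) v S =
      TM2.stepAux q v (fun k => if k ∈ ks then (f k v).toList ++ S k else S k) := by
  induction ks generalizing S with
  | nil => simp [pushAll]
  | cons k ks ih =>
    rw [List.nodup_cons] at hks
    rw [pushAll, stepAux_pushOpt, ih hks.2]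
    congr 1
    funext j
    by_cases hj : j = k
    · subst hj; simp [hks.1]
    · simp [hj]

variable [Fintype K]

/-- Pop all symbols of the stack `a`; after each of them update the state by `δ`, and push on each
stack `k` what `out k` says; at the end, push on each stack `k` what `fin k` says. -/
noncomputable def drain (a : K) {Q : Type} [Fintype Q] (s₀ : Q) (δ : Q → Γ a → Q)
    (out fin : ∀ k, Q → Option (Γ k)) : Prog K Γ where
  Λ := Unit
  σ := Q × Bool
  main := ()
  init := (s₀, false)
  m _ := .pop a (fun s o => o.elim (s.1, false) (fun γ => (δ s.1 γ, true)))
    (.branch Prod.snd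
      (pushAll (fun k s => out k s.1) (.goto fun _ => ()) Finset.univ.toList)
      (pushAll (fun k s => fin k s.1) .halt Finset.univ.toList))

/-- Each symbol costs one step, and one more step finds the stack empty. Pushing reverses the order
of the output. By `hout` nothing is pushed back on `a` while it is being emptied. -/
theorem runs_drain (a : K) {Q : Type} [Fintype Q] (s₀ : Q) (δ : Q → Γ a → Q)
    (out fin : ∀ k, Q → Option (Γ k)) (hout : ∀ s, out a s = none) (S : ∀ k, List (Γ k)) :
    (drain a s₀ δ out fin).Runs S ((S a).length + 1) (fun k =>
      (fin k ((S a).foldl δ s₀)).toList ++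
        ((transduce δ (out k) s₀ (S a)).reverse ++ update S a [] k)) := by
  have key : ∀ (l : List (Γ a)) (s : Q) (b : Bool) (S S' : ∀ k, List (Γ k)), S a = l →
      (∀ k, S' k = (fin k (l.foldl δ s)).toList ++
        ((transduce δ (out k) s l).reverse ++ update S a [] k)) →
      StepsTo (drain a s₀ δ out fin).m (l.length + 1) ⟨some (), (s, b), S⟩
        ⟨none, (l.foldl δ s, false), S'⟩ := by
    intro l
    induction l with
    | nil =>
      intro s b S S' hS hS'
      obtain rfl := funext hS'
      refine .step ?_
      simp only [drain, TM2.stepAux, hS, List.head?_nil, Option.elim_none, cond_false,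
        stepAux_pushAll _ _ _ _ (Finset.nodup_toList _), Finset.mem_toList, Finset.mem_univ,
        if_true, List.tail_nil, List.foldl_nil, transduce, List.reverse_nil, List.nil_append]
      exact .refl _
    | cons γ l ih =>
      intro s b S S' hS hS'
      refine .step ?_
      simp only [drain, TM2.stepAux, hS, List.head?_cons, Option.elim_some, cond_true,
        stepAux_pushAll _ _ _ _ (Finset.nodup_toList _), Finset.mem_toList, Finset.mem_univ,
        if_true, List.tail_cons, List.foldl_cons]
      refine ih (δ s γ) true (fun k => (out k (δ s γ)).toList ++ update S a l k) S'
        (by simp [hout]) fun k => ?_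
      rw [hS', List.foldl_cons, transduce, List.reverse_append, List.append_assoc]
      congr 2
      by_cases hk : k = a
      · subst hk; simp [hout]
      · have : (out k (δ s γ)).toList.reverse = (out k (δ s γ)).toList := by
          cases out k (δ s γ) <;> rfl
        simp [hk, this]
  exact ⟨_, le_rfl, _, key (S a) s₀ false S _ rfl fun _ => rfl⟩

end Prog

end ClusterComputing

namespace ClusterComputing

open Turing Function

/-! ### Moving stacks -/

/-- The stacks that hold `l` at `k`, `l'` at `k'`, and are empty elsewhere. -/
def double {K : Type} [DecidableEq K] {Γ : K → Type} (k : K) (l : List (Γ k)) (k' : K)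
    (l' : List (Γ k')) : ∀ k, List (Γ k) :=
  update (single k l) k' l'

section Stacks

variable {K : Type} [DecidableEq K] {Γ : K → Type}

theorem double_comm {k k' : K} (h : k ≠ k') (l : List (Γ k)) (l' : List (Γ k')) :
    double k l k' l' = double k' l' k l :=
  (update_comm (β := fun k => List (Γ k)) h l l' fun _ => [])

theorem single_comp {K' : Type} [DecidableEq K'] {Γ' : K' → Type} {ι : K → K'}
    (hι : Injective ι) (k : K) (l : List (Γ' (ι k))) :
    (fun j => single (ι k) l (ι j)) = single (Γ := fun j => Γ' (ι j)) k l :=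
  update_comp_eq_of_injective' (β := fun j => List (Γ' j)) (fun _ => []) hι k l

theorem double_comp {K' : Type} [DecidableEq K'] {Γ' : K' → Type} {ι : K → K'}
    (hι : Injective ι) (k : K) (l : List (Γ' (ι k))) {k' : K'} (hk' : k' ∉ Set.range ι)
    (l' : List (Γ' k')) :
    (fun j => double (ι k) l k' l' (ι j)) = single (Γ := fun j => Γ' (ι j)) k l := by
  rw [← single_comp hι]
  funext j
  exact update_of_ne (fun h => hk' ⟨j, h⟩) _ _

theorem length_double_le (k : K) (l : List (Γ k)) (k' : K) (l' : List (Γ k')) (j : K) :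
    (double k l k' l' j).length ≤ l.length + l'.length := by
  unfold double single
  by_cases h' : j = k'
  · subst h'; simp
  · by_cases h : j = k
    · subst h; simp [h']
    · simp [h, h']

end Stacks

namespace Prog

variable {K : Type} [DecidableEq K] {Γ : K → Type}

theorem Runs.lift_single {K' : Type} [DecidableEq K'] {Γ' : K' → Type} {ι : K → K'}
    (hι : Injective ι) {F : Prog K (fun k => Γ' (ι k))} {k k' : K} {l : List (Γ' (ι k))}
    {l' : List (Γ' (ι k'))} {T : ℕ} (h : F.Runs (single k l) T (single k' l')) :
    (F.lift ι).Runs (single (ι k) l) T (single (ι k') l') := by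
  refine Runs.lift hι ?_ fun j hj => ?_
  · rwa [single_comp hι, single_comp hι]
  · unfold single
    rw [update_of_ne, update_of_ne] <;> rintro rfl <;> exact hj ⟨_, rfl⟩

theorem Runs.lift_double {K' : Type} [DecidableEq K'] {Γ' : K' → Type} {ι : K → K'}
    (hι : Injective ι) {F : Prog K (fun k => Γ' (ι k))} {k k' : K} {l : List (Γ' (ι k))}
    {l' : List (Γ' (ι k'))} {T : ℕ} (h : F.Runs (single k l) T (single k' l')) {j : K'}
    (hj : j ∉ Set.range ι) (m : List (Γ' j)) :
    (F.lift ι).Runs (double (ι k) l j m) T (double (ι k') l' j m) := by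
  refine Runs.lift hι ?_ fun i hi => ?_
  · rwa [double_comp hι _ _ hj, double_comp hι _ _ hj]
  · unfold double
    by_cases hij : i = j
    · subst hij; simp
    · rw [update_of_ne hij, update_of_ne hij]
      unfold single
      rw [update_of_ne, update_of_ne] <;> rintro rfl <;> exact hi ⟨_, rfl⟩

variable [Fintype K]

/-- Pop all symbols of the stack `a`, and push on each stack `k` their images under `f k`. -/
noncomputable def move (a : K) [Fintype (Γ a)] (f : ∀ k, Γ a → Option (Γ k)) : Prog K Γ :=
  drain a (Q := Option (Γ a)) none (fun _ γ => some γ) (fun k s => s.bind (f k))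
    (fun _ _ => none)

theorem runs_move (a : K) [Fintype (Γ a)] (f : ∀ k, Γ a → Option (Γ k))
    (hf : ∀ γ, f a γ = none) {S S' : ∀ k, List (Γ k)}
    (hS : ∀ k, S' k = ((S a).filterMap (f k)).reverse ++ update S a [] k) :
    (move a f).Runs S ((S a).length + 1) S' := by
  have key : ∀ (k : K) (l : List (Γ a)) (s : Option (Γ a)),
      transduce (fun _ γ => some γ) (fun s => s.bind (f k)) s l = l.filterMap (f k) := by
    intro k l
    induction l with
    | nil => intro s; rfl
    | cons γ l ih =>
      intro s
      rw [transduce, ih, List.filterMap_cons]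
      simp only [Option.bind_some]
      cases f k γ <;> rfl
  convert runs_drain a (Q := Option (Γ a)) none (fun _ γ => some γ) (fun k s => s.bind (f k))
    (fun _ _ => none) (fun s => by cases s <;> simp [hf]) S using 1
  · rfl
  · funext k
    rw [hS, key]
    rfl

/-- Move the stack `a` to the stack `b`, in the reverse order. -/
noncomputable def moveTo (a b : K) [Fintype (Γ a)] (g : Γ a → Γ b) : Prog K Γ :=
  move a (update (fun _ _ => none) b fun γ => some (g γ))

theorem runs_moveTo {a b : K} [Fintype (Γ a)] (g : Γ a → Γ b) (hab : a ≠ b)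
    {S S' : ∀ k, List (Γ k)} {l : List (Γ a)} (hl : S a = l) (ha : S' a = [])
    (hb : S' b = (l.map g).reverse ++ S b) (h : ∀ k, k ≠ a → k ≠ b → S' k = S k) :
    (moveTo a b g).Runs S (l.length + 1) S' := by
  subst hl
  refine runs_move a _ (fun γ => by simp [hab]) fun k => ?_
  by_cases hk : k = b
  · subst hk
    simp [hab.symm, hb]
  · by_cases hk' : k = a
    · subst hk'; simp [ha, hk]
    · simp [hk, hk', h]

theorem runs_moveTo_single {a b : K} [Fintype (Γ a)] {g : Γ a → Γ b} (hab : a ≠ b)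
    {l : List (Γ a)} {l' : List (Γ b)} {n : ℕ} (hl : (l.map g).reverse = l')
    (hn : l'.length ≤ n) :
    (moveTo a b g).Runs (single a l) (n + 1) (single b l') := by
  have hn' : l.length + 1 ≤ n + 1 := by simpa [← hl] using hn
  refine (runs_moveTo g hab ?_ ?_ ?_ fun k hk hk' => ?_).mono hn' <;>
    simp_all [single, hab.symm]

theorem runs_moveTo_double {a b : K} [Fintype (Γ a)] {g : Γ a → Γ b} (hab : a ≠ b) {j : K}
    (hja : j ≠ a) (hjb : j ≠ b) {l : List (Γ a)} {l' : List (Γ b)} {n : ℕ}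
    (hl : (l.map g).reverse = l') (hn : l'.length ≤ n) (m : List (Γ j)) :
    (moveTo a b g).Runs (double j m a l) (n + 1) (double j m b l') := by
  have hn' : l.length + 1 ≤ n + 1 := by simpa [← hl] using hn
  refine (runs_moveTo g hab ?_ ?_ ?_ fun k hk hk' => ?_).mono hn' <;>
    simp [double, single, hab.symm, hja.symm, hjb.symm, *]

theorem runs_moveTo_onto {a b : K} [Fintype (Γ a)] {g : Γ a → Γ b} (hab : a ≠ b)
    {l : List (Γ a)} {l' : List (Γ b)} {n : ℕ} (hl : (l.map g).reverse = l')
    (hn : l'.length ≤ n) (m : List (Γ b)) :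
    (moveTo a b g).Runs (double b m a l) (n + 1) (single b (l' ++ m)) := by
  have hn' : l.length + 1 ≤ n + 1 := by simpa [← hl] using hn
  refine (runs_moveTo g hab ?_ ?_ ?_ fun k hk hk' => ?_).mono hn' <;>
    simp [double, single, hab.symm, *]

theorem runs_drain_single {a b : K} (hab : a ≠ b) {Q : Type} [Fintype Q] {s₀ : Q}
    {δ : Q → Γ a → Q} {out fin : Q → Option (Γ b)} {l : List (Γ a)} {l' : List (Γ b)}
    (hl : transduce δ out s₀ l ++ (fin (l.foldl δ s₀)).toList = l') :
    (drain a s₀ δ (update (fun _ _ => none) b out) (update (fun _ _ => none) b fin)).Runs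
      (single a l) (l.length + 1) (single b l'.reverse) := by
  have r := runs_drain a s₀ δ (update (fun _ _ => none) b out) (update (fun _ _ => none) b fin)
    (fun s => by simp [hab]) (single a l)
  have e : single a l a = l := by simp [single]
  rw [e] at r
  convert r using 1
  funext k
  by_cases hk : k = b
  · subst hk
    have : (fin (l.foldl δ s₀)).toList.reverse = (fin (l.foldl δ s₀)).toList := by
      cases fin (l.foldl δ s₀) <;> rfl
    simp [single, ← hl, this, hab.symm]
  · by_cases hk' : k = a
    · subst hk'
      simp [single, hk, transduce_none]
    · simp [single, hk, hk', transduce_none]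

/-- Copy the stack `a` to the stacks `b` and `c`, in the reverse order, and erase it. -/
noncomputable def copyTo (a b c : K) [Fintype (Γ a)] (g : Γ a → Option (Γ b))
    (g' : Γ a → Option (Γ c)) : Prog K Γ :=
  move a (update (update (fun _ _ => none) b g) c g')

theorem runs_copyTo {a b c : K} [Fintype (Γ a)] {g : Γ a → Option (Γ b)}
    {g' : Γ a → Option (Γ c)} (hab : a ≠ b) (hac : a ≠ c) (hbc : b ≠ c) {l : List (Γ a)}
    {l₁ : List (Γ b)} {l₂ : List (Γ c)} {n : ℕ} (h₁ : (l.filterMap g).reverse = l₁)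
    (h₂ : (l.filterMap g').reverse = l₂) (hn : l.length ≤ n) :
    (copyTo a b c g g').Runs (single a l) (n + 1) (double b l₁ c l₂) := by
  subst h₁ h₂
  have e : single a l a = l := by simp [single]
  have h := runs_move (S := single a l)
    (S' := double b (l.filterMap g).reverse c (l.filterMap g').reverse) a
    (update (update (fun _ _ => none) b g) c g') (fun γ => by simp [hab, hac]) (fun k => by
      by_cases hc : k = c
      · subst hc; simp [double, single, hac.symm]
      · by_cases hb : k = b
        · subst hb; simp [double, single, hab.symm, hbc]
        · simp [double, single, hb, hc])
  rw [e] at h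
  exact h.mono (Nat.add_le_add_right hn 1)

end Prog

end ClusterComputing

namespace ClusterComputing

open Turing Function Computability

/-! ### Closure properties of the polynomial-time computable functions -/

/-- `f` is computable in polynomial time, for the encodings `ea` and `eb`. -/
def PolyFn {α β A B : Type} (ea : α → List A) (eb : β → List B) (f : α → β) : Prop :=
  Nonempty (TM2ComputableInPolyTime ea eb f)

theorem eval_mono (p : Polynomial ℕ) {m n : ℕ} (h : m ≤ n) : p.eval m ≤ p.eval n := by
  simp only [Polynomial.eval_eq_sum, Polynomial.sum]
  gcongr

theorem reverse_map_reverse' {X Y : Type} (f : X → Y) (l : List X) :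
    (l.reverse.map f).reverse = l.map f := by simp

theorem reverse_filterMap_reverse {X Y : Type} (f : X → Y) (l : List X) :
    (l.reverse.filterMap fun x => some (f x)).reverse = l.map f := by simp

theorem reverse_map_equiv {X Y Z : Type} (e : X ≃ Y) (f : Y → Z) (l : List Y) :
    ((l.map e.symm).map fun x => f (e x)).reverse = (l.map f).reverse := by
  simp [Function.comp_def]

section Closure

variable {α β γ A B C : Type} {ea : α → List A} {eb : β → List B} {ec : γ → List C}

theorem PolyFn.of_prog {f : α → β} {K : Type} [DecidableEq K] [Fintype K] {Γ : K → Type}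
    (F : Prog K Γ) {k₀ k₁ : K} [Fintype (Γ k₀)] (e₀ : Γ k₀ ≃ A) (e₁ : Γ k₁ ≃ B)
    (T : Polynomial ℕ)
    (h : ∀ a, ∃ l l', (ea a).map e₀.symm = l ∧ (eb (f a)).map e₁.symm = l' ∧
      F.Runs (single k₀ l) (T.eval (ea a).length) (single k₁ l')) : PolyFn ea eb f :=
  ⟨{ tm := F.toTM k₀ k₁
     inputAlphabet := e₀
     outputAlphabet := e₁
     time := T
     outputsFun := fun a => Classical.choice <| by
       obtain ⟨l, l', rfl, rfl, hr⟩ := h a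
       exact hr.outputs }⟩

/-- `L` is the input length plus the pushes per step times the running time. -/
theorem PolyFn.exists_runs {f : α → β} (h : PolyFn ea eb f) :
    ∃ (tm : FinTM2) (e₀ : tm.Γ tm.k₀ ≃ A) (e₁ : tm.Γ tm.k₁ ≃ B) (T L : Polynomial ℕ), ∀ a,
      (Prog.ofTM tm).Runs (single tm.k₀ ((ea a).map e₀.symm)) (T.eval (ea a).length)
        (single tm.k₁ ((eb (f a)).map e₁.symm)) ∧ (eb (f a)).length ≤ L.eval (ea a).length := by
  obtain ⟨c⟩ := h
  obtain ⟨N, hN⟩ := exists_pushes_le (Prog.ofTM c.tm).m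
  refine ⟨c.tm, c.inputAlphabet, c.outputAlphabet, c.time, Polynomial.X + Polynomial.C N * c.time,
    fun a => ?_⟩
  have hr := Prog.runs_ofTM (c.outputsFun a)
  refine ⟨hr, ?_⟩
  have hl := hr.length_le hN c.tm.k₁
  have h0 : (single c.tm.k₀ ((ea a).map c.inputAlphabet.invFun) c.tm.k₁).length
      ≤ (ea a).length := by
    unfold single
    by_cases hk : c.tm.k₁ = c.tm.k₀
    · rw [hk]; simp
    · simp [hk]
  simp only [single, update_self, List.length_map] at hl
  simp only [Polynomial.eval_add, Polynomial.eval_X, Polynomial.eval_mul,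
    Polynomial.eval_C]
  exact hl.trans (Nat.add_le_add_right h0 _)

/-- The composition of polynomial-time computable functions is polynomial-time computable. -/
theorem PolyFn.comp [iB : Fintype B] {g : β → γ} {f : α → β} (hg : PolyFn eb ec g)
    (hf : PolyFn ea eb f) : PolyFn ea ec (fun a => g (f a)) := by
  obtain ⟨M, e₀, e₁, T, L, hM⟩ := hf.exists_runs
  obtain ⟨M', e₀', e₁', T', L', hM'⟩ := hg.exists_runs
  let Γ : Unit ⊕ (M.K ⊕ M'.K) → Type := Sum.elim (fun _ => B) (Sum.elim M.Γ M'.Γ)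
  let _ : Fintype (Γ (.inr (.inl M.k₁))) := Fintype.ofEquiv _ e₁.symm
  let _ : Fintype (Γ (.inl ())) := iB
  let _ : Fintype (Γ (.inr (.inl M.k₀))) := M.Γk₀Fin
  let ι : M.K → Unit ⊕ (M.K ⊕ M'.K) := fun k => .inr (.inl k)
  let ι' : M'.K → Unit ⊕ (M.K ⊕ M'.K) := fun k => .inr (.inr k)
  have hι : Injective ι := Sum.inr_injective.comp Sum.inl_injective
  have hι' : Injective ι' := Sum.inr_injective.comp Sum.inr_injective
  let F₁ : Prog _ Γ := (Prog.ofTM M).lift ι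
  -- Moving a stack reverses it, so the intermediate result passes through an auxiliary stack and is
  -- moved twice.
  let F₂ : Prog _ Γ := Prog.moveTo (Γ := Γ) (.inr (.inl M.k₁)) (.inl ()) e₁
  let F₃ : Prog _ Γ := Prog.moveTo (Γ := Γ) (.inl ()) (.inr (.inr M'.k₀)) e₀'.symm
  let F₄ : Prog _ Γ := (Prog.ofTM M').lift ι'
  refine PolyFn.of_prog (((F₁.seq F₂).seq F₃).seq F₄) (k₀ := .inr (.inl M.k₀))
    (k₁ := .inr (.inr M'.k₁)) e₀ e₁' (T + (L + 1) + (L + 1) + T'.comp L) fun a => ?_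
  obtain ⟨h₁, hl⟩ := hM a
  obtain ⟨h₂, -⟩ := hM' (f a)
  have r₁ := Prog.Runs.lift_single (Γ' := Γ) hι h₁
  have r₂ := Prog.runs_moveTo_single (Γ := Γ) (a := .inr (.inl M.k₁)) (b := .inl ()) (g := e₁)
    (l := (eb (f a)).map e₁.symm) (l' := (eb (f a)).reverse) (by simp)
    ((reverse_map_equiv e₁ id _).trans (by rw [List.map_id]))
    ((List.length_reverse (as := eb (f a))).trans_le hl)
  have r₃ := Prog.runs_moveTo_single (Γ := Γ) (a := .inl ()) (b := .inr (.inr M'.k₀))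
    (g := e₀'.symm) (l := (eb (f a)).reverse) (l' := (eb (f a)).map e₀'.symm) (by simp)
    (reverse_map_reverse' e₀'.symm (eb (f a)))
    ((List.length_map (as := eb (f a)) e₀'.symm).trans_le hl)
  have r₄ := Prog.Runs.lift_single (Γ' := Γ) hι' h₂
  refine ⟨_, _, rfl, rfl, (((r₁.seq r₂).seq r₃).seq r₄).mono ?_⟩
  simp only [Polynomial.eval_add, Polynomial.eval_one, Polynomial.eval_comp]
  gcongr
  exact eval_mono _ hl

/-- The encoding of pairs: the two codes are written one after the other, in disjoint alphabets. -/
def encPair (eb : β → List B) (ec : γ → List C) : β × γ → List (B ⊕ C) :=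
  fun x => (eb x.1).map .inl ++ (ec x.2).map .inr

/-- Pairs of polynomial-time computable functions are polynomial-time computable. -/
theorem PolyFn.pair [iA : Fintype A] [Fintype B] [Fintype C] {f : α → β} {g : α → γ}
    (hf : PolyFn ea eb f) (hg : PolyFn ea ec g) :
    PolyFn ea (encPair eb ec) (fun a => (f a, g a)) := by
  obtain ⟨M, e₀, e₁, T, L, hM⟩ := hf.exists_runs
  obtain ⟨M', e₀', e₁', T', L', hM'⟩ := hg.exists_runs
  let Γ : (Bool ⊕ Bool) ⊕ (M.K ⊕ M'.K) → Type :=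
    Sum.elim (Sum.elim (fun _ => A) (fun _ => B ⊕ C)) (Sum.elim M.Γ M'.Γ)
  have iBC : Fintype (B ⊕ C) := inferInstance
  let _ : ∀ b, Fintype (Γ (.inl (.inl b))) := fun b => iA
  let _ : ∀ b, Fintype (Γ (.inl (.inr b))) := fun b => iBC
  let _ : Fintype (Γ (.inr (.inl M.k₁))) := Fintype.ofEquiv _ e₁.symm
  let _ : Fintype (Γ (.inr (.inr M'.k₁))) := Fintype.ofEquiv _ e₁'.symm
  let ι : M.K → (Bool ⊕ Bool) ⊕ (M.K ⊕ M'.K) := fun k => .inr (.inl k)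
  let ι' : M'.K → (Bool ⊕ Bool) ⊕ (M.K ⊕ M'.K) := fun k => .inr (.inr k)
  have hι : Injective ι := Sum.inr_injective.comp Sum.inl_injective
  have hι' : Injective ι' := Sum.inr_injective.comp Sum.inr_injective
  let inp : (Bool ⊕ Bool) ⊕ (M.K ⊕ M'.K) := .inl (.inl false)
  let tmp : (Bool ⊕ Bool) ⊕ (M.K ⊕ M'.K) := .inl (.inl true)
  let tmp' : (Bool ⊕ Bool) ⊕ (M.K ⊕ M'.K) := .inl (.inr false)
  let out : (Bool ⊕ Bool) ⊕ (M.K ⊕ M'.K) := .inl (.inr true)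
  let G₁ : Prog _ Γ := Prog.moveTo (Γ := Γ) inp tmp id
  let G₂ : Prog _ Γ := Prog.copyTo (Γ := Γ) tmp (ι M.k₀) (ι' M'.k₀) (fun x => some (e₀.symm x))
    (fun x => some (e₀'.symm x))
  let G₃ : Prog _ Γ := (Prog.ofTM M).lift ι
  let G₄ : Prog _ Γ := (Prog.ofTM M').lift ι'
  -- The second component is transferred first, so that the first one ends on top of it.
  let G₅ : Prog _ Γ := Prog.moveTo (Γ := Γ) (ι' M'.k₁) tmp' (fun x => .inr (e₁' x))
  let G₆ : Prog _ Γ := Prog.moveTo (Γ := Γ) tmp' out id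
  let G₇ : Prog _ Γ := Prog.moveTo (Γ := Γ) (ι M.k₁) tmp' (fun x => .inl (e₁ x))
  refine PolyFn.of_prog (((((((G₁.seq G₂).seq G₃).seq G₄).seq G₅).seq G₆).seq G₇).seq G₆)
    (k₀ := inp) (k₁ := out) (Equiv.refl A) (Equiv.refl (B ⊕ C))
    ((Polynomial.X + 1) + (Polynomial.X + 1) + T + T' + (L' + 1) + (L' + 1) + (L + 1) + (L + 1))
    fun a => ?_
  obtain ⟨h₃, hl⟩ := hM a
  obtain ⟨h₄, hl'⟩ := hM' a
  have r₁ := Prog.runs_moveTo_single (Γ := Γ) (a := inp) (b := tmp) (g := id) (l := ea a)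
    (l' := (ea a).reverse) (by simp [inp, tmp])
    (by change ((ea a).map id).reverse = _; simp) (List.length_reverse (as := ea a)).le
  have r₂ := Prog.runs_copyTo (Γ := Γ) (a := tmp) (b := ι M.k₀) (c := ι' M'.k₀)
    (g := fun x => some (e₀.symm x)) (g' := fun x => some (e₀'.symm x))
    (l := (ea a).reverse) (l₁ := (ea a).map e₀.symm) (l₂ := (ea a).map e₀'.symm)
    (by simp [tmp, ι]) (by simp [tmp, ι']) (by simp [ι, ι'])
    (reverse_filterMap_reverse e₀.symm (ea a))
    (reverse_filterMap_reverse e₀'.symm (ea a))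
    (List.length_reverse (as := ea a)).le
  have r₃ := Prog.Runs.lift_double (Γ' := Γ) hι h₃ (j := ι' M'.k₀) (by simp [ι, ι'])
    ((ea a).map e₀'.symm)
  have r₄ := Prog.Runs.lift_double (Γ' := Γ) hι' h₄ (j := ι M.k₁) (by simp [ι, ι'])
    ((eb (f a)).map e₁.symm)
  have r₅ := Prog.runs_moveTo_double (Γ := Γ) (a := ι' M'.k₁) (b := tmp')
    (g := fun x => .inr (e₁' x)) (l := (ec (g a)).map e₁'.symm)
    (l' := (((ec (g a)).map Sum.inr).reverse : List (B ⊕ C))) (by simp [tmp', ι']) (j := ι M.k₁) (by simp [ι, ι'])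
    (by simp [ι, tmp'])
    (reverse_map_equiv e₁' Sum.inr (ec (g a)))
    (by change (((ec (g a)).map Sum.inr).reverse : List (B ⊕ C)).length ≤ _; simpa using hl')
    ((eb (f a)).map e₁.symm)
  have r₆ := Prog.runs_moveTo_double (Γ := Γ) (a := tmp') (b := out) (g := id)
    (l := ((ec (g a)).map .inr).reverse) (l' := (ec (g a)).map .inr)
    (by simp [tmp', out]) (j := ι M.k₁) (by simp [ι, tmp']) (by simp [ι, out])
    ((reverse_map_reverse' id _).trans (List.map_id _))
    (by change ((ec (g a)).map Sum.inr : List (B ⊕ C)).length ≤ _; simpa using hl')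
    ((eb (f a)).map e₁.symm)
  have r₇ := Prog.runs_moveTo_double (Γ := Γ) (a := ι M.k₁) (b := tmp')
    (g := fun x => .inl (e₁ x)) (l := (eb (f a)).map e₁.symm)
    (l' := (((eb (f a)).map Sum.inl).reverse : List (B ⊕ C))) (by simp [tmp', ι]) (j := out) (by simp [ι, out])
    (by simp [out, tmp'])
    (reverse_map_equiv e₁ Sum.inl (eb (f a)))
    (by change (((eb (f a)).map Sum.inl).reverse : List (B ⊕ C)).length ≤ _; simpa using hl)
    ((ec (g a)).map .inr)
  have r₈ := Prog.runs_moveTo_onto (Γ := Γ) (a := tmp') (b := out) (g := id)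
    (l := ((eb (f a)).map .inl).reverse) (l' := (eb (f a)).map .inl) (by simp [tmp', out])
    ((reverse_map_reverse' id _).trans (List.map_id _))
    (by change ((eb (f a)).map Sum.inl : List (B ⊕ C)).length ≤ _; simpa using hl)
    ((ec (g a)).map .inr)
  have c₁ := double_comm (Γ := Γ) (k := ι M.k₁) (k' := ι' M'.k₀) (by simp [ι, ι'])
    ((eb (f a)).map e₁.symm) ((ea a).map e₀'.symm)
  have c₂ := double_comm (Γ := Γ) (k := ι M.k₁) (k' := ι' M'.k₁) (by simp [ι, ι'])
    ((eb (f a)).map e₁.symm) ((ec (g a)).map e₁'.symm)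
  have c₃ := double_comm (Γ := Γ) (k := ι M.k₁) (k' := out) (by simp [ι, out])
    ((eb (f a)).map e₁.symm) ((ec (g a)).map .inr)
  have r := ((((((r₁.seq r₂).seq (c₁ ▸ r₃)).seq r₄).seq (c₂ ▸ r₅)).seq r₆).seq
    (c₃.symm ▸ r₇)).seq r₈
  refine ⟨_, _, List.map_id _, List.map_id _, r.mono (le_of_eq ?_)⟩
  simp only [Polynomial.eval_add, Polynomial.eval_one, Polynomial.eval_X]

end Closure

end ClusterComputing

namespace ClusterComputing

open Turing Function Computability

/-! ### Finite transducers, projections and Boolean connectives -/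

section Transducers

variable {α β γ A B C : Type} {ea : α → List A} {eb : β → List B} {ec : γ → List C}

/-- Functions computed by finite-state transducers are polynomial-time computable. -/
theorem PolyFn.transducer [iA : Fintype A] [iB : Fintype B] {f : α → β} {Q : Type} [Fintype Q]
    (s₀ : Q) (δ : Q → A → Q) (out fin : Q → Option B)
    (h : ∀ a, eb (f a) = transduce δ out s₀ (ea a) ++ (fin ((ea a).foldl δ s₀)).toList) :
    PolyFn ea eb f := by
  let Γ : Unit ⊕ Bool → Type := Sum.elim (fun _ => A) (fun _ => B)
  let _ : Fintype (Γ (.inl ())) := iA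
  let _ : ∀ b, Fintype (Γ (.inr b)) := fun _ => iB
  let F₁ : Prog _ Γ := Prog.drain (Γ := Γ) (.inl ()) s₀ δ
    (update (fun _ _ => none) (.inr false) out) (update (fun _ _ => none) (.inr false) fin)
  let F₂ : Prog _ Γ := Prog.moveTo (Γ := Γ) (.inr false) (.inr true) id
  have hlen : ∀ (l : List A) (s : Q), (transduce δ out s l).length ≤ l.length := by
    intro l
    induction l with
    | nil => intro s; simp [transduce]
    | cons a l ih =>
      intro s
      have := ih (δ s a)
      simp only [transduce, List.length_append, List.length_cons]
      cases out (δ s a) <;> simp <;> omega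
  refine PolyFn.of_prog (F₁.seq F₂) (k₀ := .inl ()) (k₁ := .inr true) (Equiv.refl A)
    (Equiv.refl B) ((Polynomial.X + 1) + (Polynomial.X + 1 + 1)) fun a => ?_
  have r₁ := Prog.runs_drain_single (Γ := Γ) (a := .inl ()) (b := .inr false) (s₀ := s₀)
    (δ := δ) (out := out) (fin := fin) (l := ea a) (by simp) (h a).symm
  have r₂ := Prog.runs_moveTo_single (Γ := Γ) (a := .inr false) (b := .inr true) (g := id)
    (l := (eb (f a)).reverse) (l' := eb (f a)) (n := (ea a).length + 1) (by simp)
    ((reverse_map_reverse' id _).trans (List.map_id _)) (by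
      change (eb (f a)).length ≤ _
      rw [h, List.length_append]
      have := hlen (ea a) s₀
      cases fin ((ea a).foldl δ s₀) <;> simp <;> omega)
  refine ⟨_, _, List.map_id _, List.map_id _, (r₁.seq r₂).mono (le_of_eq ?_)⟩
  simp only [Polynomial.eval_add, Polynomial.eval_one, Polynomial.eval_X]
  rfl

theorem transduce_some {A B : Type} (g : A → Option B) (s : Option A) (l : List A) :
    transduce (fun _ a => some a) (fun s => s.bind g) s l = l.filterMap g := by
  induction l generalizing s with
  | nil => rfl
  | cons a l ih =>
    rw [transduce, ih, List.filterMap_cons]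
    simp only [Option.bind_some]
    cases g a <;> rfl

theorem PolyFn.filterMap [Fintype A] [Fintype B] {f : α → β} (g : A → Option B)
    (h : ∀ a, eb (f a) = (ea a).filterMap g) : PolyFn ea eb f :=
  .transducer (Q := Option A) none (fun _ a => some a) (fun s => s.bind g) (fun _ => none)
    fun a => by rw [h, transduce_some]; simp

/-- Functions computed by finite automata are polynomial-time computable. -/
theorem PolyFn.automaton [Fintype A] {f : α → Bool} {Q : Type} [Fintype Q]
    (s₀ : Q) (δ : Q → A → Q) (out : Q → Bool) (h : ∀ a, f a = out ((ea a).foldl δ s₀)) :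
    PolyFn ea encodeBool f :=
  .transducer s₀ δ (fun _ => none) (fun s => some (out s))
    fun a => by rw [transduce_none, h]; rfl

theorem PolyFn.fst [Fintype B] [Fintype C] :
    PolyFn (encPair eb ec) eb Prod.fst :=
  .filterMap Sum.getLeft? fun a => by
    simp [encPair, List.filterMap_append, List.filterMap_map, Function.comp_def]

theorem PolyFn.snd [Fintype B] [Fintype C] :
    PolyFn (encPair eb ec) ec Prod.snd :=
  .filterMap Sum.getRight? fun a => by
    simp [encPair, List.filterMap_append, List.filterMap_map, Function.comp_def]

theorem PolyFn.bool₂ [Fintype A] {f g : α → Bool} (op : Bool → Bool → Bool)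
    (hf : PolyFn ea encodeBool f) (hg : PolyFn ea encodeBool g) :
    PolyFn ea encodeBool (fun a => op (f a) (g a)) :=
  PolyFn.comp (g := fun p : Bool × Bool => op p.1 p.2)
    (.automaton (Q := Bool × Bool) (false, false)
      (fun s b => b.elim (fun b => (b, s.2)) (fun b => (s.1, b))) (fun s => op s.1 s.2)
      fun _ => rfl) (hf.pair hg)

end Transducers

/-! ### Polynomial-time operations on strings -/

section Strings

variable {α A : Type} {ea : α → List A}

/-- The encoding of strings. -/
abbrev encStr : Str → List Bool := fun w => w

theorem PolyFn.tail {f : α → Str} (hf : PolyFn ea encStr f) :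
    PolyFn ea encStr (fun a => (f a).tail) := by
  -- The states: `none` before the first symbol, `some none` right after it, and `some (some b)`
  -- after a later symbol `b`, which is then output.
  refine PolyFn.comp (g := List.tail) (.transducer (Q := Option (Option Bool)) none
    (fun s b => if s = none then some none else some (some b)) (fun s => s.join)
    (fun _ => none) fun l => ?_) hf
  have h : ∀ (l : List Bool) (s : Option Bool), transduce
      (fun s b => if s = none then some none else some (some b)) (fun s => s.join) (some s) l
        = l := by
    intro l
    induction l with
    | nil => intro s; rfl
    | cons b l ih => intro s; simp [transduce, ih]
  cases l with
  | nil => rfl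
  | cons b l =>
    change l = [] ++ transduce _ _ (some none) l ++ []
    rw [h]; simp

theorem PolyFn.head {f : α → Str} (hf : PolyFn ea encStr f) :
    PolyFn ea encodeBool (fun a => (f a).headD false) := by
  refine PolyFn.comp (g := fun l : Str => l.headD false) (.automaton (Q := Option Bool) none
    (fun s b => s.elim (some b) some) (fun s => s.getD false) fun l => ?_) hf
  have h : ∀ (l : List Bool) (b : Bool),
      l.foldl (fun s b => s.elim (some b) some) (some b) = some b := by
    intro l
    induction l with
    | nil => intro b; rfl
    | cons b l ih => intro b; exact ih _
  cases l with
  | nil => rfl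
  | cons b l =>
    change b = ((l.foldl (fun s b => s.elim (some b) some) (some b)).getD false)
    rw [h]; rfl

theorem PolyFn.cons [Fintype A] {f : α → Str} (b : Bool) (hf : PolyFn ea encStr f) :
    PolyFn ea encStr (fun a => b :: f a) := by
  have hb : PolyFn ea encStr (fun _ => [b]) :=
    .transducer (Q := Unit) () (fun _ _ => ()) (fun _ => none) (fun _ => some b)
      fun a => by rw [transduce_none]; rfl
  refine PolyFn.comp (g := fun p : Str × Str => p.1 ++ p.2)
    (.filterMap (fun x => some (x.elim id id)) fun p => ?_) (hb.pair hf)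
  simp [encPair, List.filterMap_append, List.filterMap_map, Function.comp_def]

/-- Pop the first two stacks simultaneously, and push on the third one whether they are equal. -/
def compareStacks : Prog (Fin 3) (fun _ => Bool) where
  Λ := Unit
  σ := Bool × Option Bool × Option Bool
  main := ()
  init := (true, none, none)
  m _ := .pop 0 (fun s o => (s.1, o, s.2.2)) <| .pop 1 (fun s o => (s.1, s.2.1, o)) <|
    .load (fun s => (s.1 && (s.2.1 == s.2.2), s.2)) <|
    .branch (fun s => s.2.1.isNone && s.2.2.isNone) (.push 2 (fun s => s.1) .halt)
      (.goto fun _ => ())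

/-- An exhausted stack yields `none`, so different lengths show up as a mismatch. The loop ends in
the round in which both stacks yield `none`. -/
theorem runs_compareStacks (l r : Str) :
    compareStacks.Runs ![l, r, []] (l.length + r.length + 1) ![[], [], [l == r]] := by
  have key : ∀ (n : ℕ) (l r : Str) (b : Bool) (o : Option Bool × Option Bool),
      l.length + r.length ≤ n →
      ∃ t ≤ n + 1, ∃ v, StepsTo compareStacks.m t ⟨some (), (b, o), ![l, r, []]⟩
        ⟨none, v, ![[], [], [b && l == r]]⟩ := by
    have upd : ∀ (l r s : Str), update (![l, r, s] : Fin 3 → List Bool) 0 l.tail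
        = ![l.tail, r, s] := fun l r s => by
      funext k; fin_cases k <;> rfl
    have upd' : ∀ (l r s : Str), update (![l, r, s] : Fin 3 → List Bool) 1 r.tail
        = ![l, r.tail, s] := fun l r s => by
      funext k; fin_cases k <;> rfl
    have upd'' : ∀ (l r s s' : Str), update (![l, r, s] : Fin 3 → List Bool) 2 s'
        = ![l, r, s'] := fun l r s s' => by
      funext k; fin_cases k <;> rfl
    have st : ∀ (l r : Str) (b : Bool) (o : Option Bool × Option Bool),
        TM2.stepAux (compareStacks.m ()) (b, o) ![l, r, []] =
          bif l.head?.isNone && r.head?.isNone then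
            ⟨none, (b && (l.head? == r.head?), l.head?, r.head?),
              ![l.tail, r.tail, [b && (l.head? == r.head?)]]⟩
          else ⟨some (), (b && (l.head? == r.head?), l.head?, r.head?),
            ![l.tail, r.tail, []]⟩ := by
      intro l r b o
      have h1 : (![l.tail, r, []] : Fin 3 → List Bool) 1 = r := rfl
      have h2 : (![l, r, []] : Fin 3 → List Bool) 0 = l := rfl
      have h3 : (![l.tail, r.tail, []] : Fin 3 → List Bool) 2 = [] := rfl
      simp only [compareStacks, TM2.stepAux, upd, upd', upd'', h1, h2, h3]
    intro n
    induction n with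
    | zero =>
      intro l r b o h
      obtain rfl : l = [] := List.eq_nil_of_length_eq_zero (by omega)
      obtain rfl : r = [] := List.eq_nil_of_length_eq_zero (by omega)
      refine ⟨1, le_rfl, (b && true, none, none), .step ?_⟩
      rw [st]
      exact .refl _
    | succ n ih =>
      intro l r b o h
      have step : ∀ (_ : ¬ (l = [] ∧ r = [])) (c : TM2.Cfg _ _ _) (t : ℕ),
          StepsTo compareStacks.m t ⟨some (), (b && (l.head? == r.head?), l.head?, r.head?),
            ![l.tail, r.tail, []]⟩ c →
          StepsTo compareStacks.m (t + 1) ⟨some (), (b, o), ![l, r, []]⟩ c := by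
        intro hne c t h
        refine .step ?_
        have hc : (l.head?.isNone && r.head?.isNone) = false := by
          rcases l with _ | ⟨x, l⟩ <;> rcases r with _ | ⟨y, r⟩ <;> simp_all
        rw [st, hc]
        exact h
      by_cases hne : l = [] ∧ r = []
      · obtain ⟨rfl, rfl⟩ := hne
        obtain ⟨t, ht, v, hv⟩ := ih [] [] b o (by simp)
        exact ⟨t, by omega, v, hv⟩
      · obtain ⟨t, ht, v, hv⟩ := ih l.tail r.tail (b && (l.head? == r.head?))
          (l.head?, r.head?) (by
            rcases l with _ | ⟨x, l⟩ <;> rcases r with _ | ⟨y, r⟩ <;> simp_all; omega)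
        refine ⟨t + 1, by omega, v, step hne _ _ ?_⟩
        have hb : (b && (l.head? == r.head?) && l.tail == r.tail) = (b && l == r) := by
          rcases l with _ | ⟨x, l⟩ <;> rcases r with _ | ⟨y, r⟩ <;> simp [Bool.and_assoc]
        rwa [hb] at hv
  obtain ⟨t, ht, v, hv⟩ := key _ l r true (none, none) le_rfl
  exact ⟨t, ht, v, hv⟩

theorem PolyFn.eqStr : PolyFn (encPair encStr encStr) encodeBool (fun p => p.1 == p.2) := by
  let Γ : Unit ⊕ Fin 3 → Type := Sum.elim (fun _ => Bool ⊕ Bool) (fun _ => Bool)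
  have iBB : Fintype (Bool ⊕ Bool) := inferInstance
  let _ : Fintype (Γ (.inl ())) := iBB
  let F₁ : Prog _ Γ := Prog.copyTo (Γ := Γ) (.inl ()) (.inr 0) (.inr 1) Sum.getLeft?
    Sum.getRight?
  let F₂ : Prog _ Γ := Prog.lift (Γ' := Γ) .inr compareStacks
  refine PolyFn.of_prog (F₁.seq F₂) (k₀ := .inl ()) (k₁ := .inr 2) (Equiv.refl (Bool ⊕ Bool))
    (Equiv.refl Bool) ((Polynomial.X + 1) + (Polynomial.X + 1)) fun p => ?_
  have h₁ : ((encPair encStr encStr p).filterMap Sum.getLeft?).reverse = p.1.reverse := by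
    simp [encPair, List.filterMap_append, List.filterMap_map, Function.comp_def]
  have h₂ : ((encPair encStr encStr p).filterMap Sum.getRight?).reverse = p.2.reverse := by
    simp [encPair, List.filterMap_append, List.filterMap_map, Function.comp_def]
  have hl : (encPair encStr encStr p).length = p.1.length + p.2.length := by
    simp [encPair]
  have r₁ := Prog.runs_copyTo (Γ := Γ) (a := .inl ()) (b := .inr 0) (c := .inr 1)
    (g := Sum.getLeft?) (g' := Sum.getRight?) (by simp) (by simp) (by simp) h₁ h₂ hl.le
  have r₂ : F₂.Runs (double (Γ := Γ) (.inr 0) p.1.reverse (.inr 1) p.2.reverse)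
      (p.1.length + p.2.length + 1) (single (Γ := Γ) (.inr 2) [p.1 == p.2]) := by
    -- Copying has reversed both strings, which does not affect their equality.
    have r := runs_compareStacks p.1.reverse p.2.reverse
    rw [List.length_reverse, List.length_reverse] at r
    have e₁ : (fun k => double (Γ := Γ) (.inr 0) p.1.reverse (.inr 1) p.2.reverse (.inr k)) =
        ![p.1.reverse, p.2.reverse, []] := by
      funext k; fin_cases k <;> rfl
    have e₂ : (fun k => single (Γ := Γ) (.inr 2) [p.1 == p.2] (.inr k)) =
        ![[], [], [p.1.reverse == p.2.reverse]] := by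
      have : (p.1 == p.2) = (p.1.reverse == p.2.reverse) := by
        rw [Bool.eq_iff_iff]; simp
      rw [← this]
      funext k; fin_cases k <;> rfl
    refine Prog.Runs.lift Sum.inr_injective ?_ ?_
    · rwa [e₁, e₂]
    · rintro (_ | k) hk
      · rfl
      · exact (hk ⟨k, rfl⟩).elim
  refine ⟨_, _, List.map_id _, List.map_id _, (r₁.seq r₂).mono (le_of_eq ?_)⟩
  simp only [Polynomial.eval_add, Polynomial.eval_one, Polynomial.eval_X, hl]

theorem PolyFn.beq [Fintype A] {f g : α → Str} (hf : PolyFn ea encStr f)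
    (hg : PolyFn ea encStr g) : PolyFn ea encodeBool (fun a => f a == g a) :=
  eqStr.comp (hf.pair hg)

end Strings

end ClusterComputing

namespace ClusterComputing

open Turing Function Computability

/-! ### Erasing stacks -/

namespace Prog

variable {K : Type} [DecidableEq K] {Γ : K → Type}

/-- Pop a symbol from each stack of the list, and record whether there was one. -/
def popAll {Λ : Type} (q : TM2.Stmt Γ Λ Bool) : List K → TM2.Stmt Γ Λ Bool
  | [] => q
  | k :: ks => .pop k (fun s o => s || o.isSome) (popAll q ks)

theorem stepAux_popAll {Λ : Type} (q : TM2.Stmt Γ Λ Bool) (v : Bool) (ks : List K)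
    (hks : ks.Nodup) (S : ∀ k, List (Γ k)) :
    TM2.stepAux (popAll q ks) v S =
      TM2.stepAux q (v || ks.any fun k => (S k).head?.isSome)
        (fun k => if k ∈ ks then (S k).tail else S k) := by
  induction ks generalizing v S with
  | nil => simp [popAll]
  | cons k ks ih =>
    rw [List.nodup_cons] at hks
    rw [popAll, TM2.stepAux, ih _ hks.2]
    congr 1
    · rw [List.any_cons, Bool.or_assoc]
      congr 2
      rw [Bool.eq_iff_iff, List.any_eq_true, List.any_eq_true]
      refine exists_congr fun j => and_congr_right fun hj => ?_
      rw [update_of_ne (by rintro rfl; exact hks.1 hj)]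
    · funext j
      by_cases hj : j = k
      · subst hj; simp [hks.1]
      · simp [hj]

variable [Fintype K]

/-- Erase all stacks but `k₁`. -/
noncomputable def erase (k₁ : K) : Prog K Γ where
  Λ := Unit
  σ := Bool
  main := ()
  init := false
  m _ := .load (fun _ => false) <|
    popAll (.branch id (.goto fun _ => ()) .halt) (Finset.univ.erase k₁).toList

/-- A round pops all stacks but `k₁` simultaneously, so the greatest height bounds the number of
rounds; a last round finds everything empty. -/
theorem runs_erase {k₁ : K} {B : ℕ} {S : ∀ k, List (Γ k)} (hB : ∀ k, (S k).length ≤ B) :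
    (erase k₁).Runs S (B + 1) (single k₁ (S k₁)) := by
  have st : ∀ (v : Bool) (S : ∀ k, List (Γ k)),
      TM2.stepAux ((erase (Γ := Γ) k₁).m ()) v S =
        bif (Finset.univ.erase k₁).toList.any fun k => (S k).head?.isSome then
          ⟨some (), true, fun k => if k ≠ k₁ then (S k).tail else S k⟩
        else ⟨none, false, single k₁ (S k₁)⟩ := by
    intro v S
    simp only [erase, TM2.stepAux, stepAux_popAll _ _ _ (Finset.nodup_toList _),
      Finset.mem_toList, Finset.mem_erase, Finset.mem_univ, and_true, Bool.false_or]
    rcases h : (Finset.univ.erase k₁).toList.any fun k => (S k).head?.isSome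
    · simp only [id_eq, cond_false]
      congr 1
      funext k
      by_cases hk : k = k₁
      · subst hk; simp [single]
      · have := List.any_eq_false.1 h k (by simp [hk])
        have : S k = [] := by simpa using this
        simp [hk, single, this]
    · simp
  have key : ∀ (B : ℕ) (v : Bool) (S : ∀ k, List (Γ k)), (∀ k, k ≠ k₁ → (S k).length ≤ B) →
      ∃ t ≤ B + 1, StepsTo (erase (Γ := Γ) k₁).m t ⟨some (), v, S⟩
        ⟨none, false, single k₁ (S k₁)⟩ := by
    intro B
    induction B with
    | zero =>
      intro v S hS
      refine ⟨1, le_rfl, .step ?_⟩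
      have : ((Finset.univ.erase k₁).toList.any fun k => (S k).head?.isSome) = false := by
        rw [List.any_eq_false]
        intro k hk
        have h : S k = [] := List.eq_nil_of_length_eq_zero
          (Nat.le_zero.1 (hS k (by simpa using hk)))
        simp [h]
      rw [st, this]
      exact .refl _
    | succ B ih =>
      intro v S hS
      rcases h : (Finset.univ.erase k₁).toList.any fun k => (S k).head?.isSome
      · refine ⟨1, by omega, .step ?_⟩
        rw [st, h]
        exact .refl _
      · obtain ⟨t, ht, hr⟩ := ih true (fun k => if k ≠ k₁ then (S k).tail else S k)
          (fun k hk => by have := hS k hk; simp [hk]; omega)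
        refine ⟨t + 1, by omega, .step ?_⟩
        rw [st, h]
        simpa using hr
  obtain ⟨t, ht, h⟩ := key B false S fun k _ => hB k
  exact ⟨t, ht, _, h⟩

end Prog

/-! ### Deterministic simulation of nondeterministic machines -/

namespace NTM

variable (N : NTM)

/-- `u.takeD _ false` is `u` cut or prolonged by zeros: the run obeys `u` as long as it lasts and
guesses `0` thereafter. The alternative `t = n` is excluded once `n` exceeds the time bound. -/
theorem exists_run (n : ℕ) (c : N.tm.Cfg) (u : Str) : ∃ w t c', N.Run c w t c' ∧
    u.takeD w.length false = w ∧ (c'.l = none ∨ t = n) := by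
  induction n generalizing c u with
  | zero => exact ⟨[], 0, c, .refl c, rfl, .inr rfl⟩
  | succ n ih =>
    rcases hl : c.l with _ | l
    · exact ⟨[], 0, c, .refl c, rfl, .inl hl⟩
    rcases ha : N.alt l with _ | s
    · obtain ⟨w, t, c', h, hw, hc⟩ := ih (N.exec (N.tm.m l) c) u
      exact ⟨w, t + 1, c', .det hl ha h, hw, hc.imp_right fun e => by rw [e]⟩
    rcases hu : u.headD false
    · obtain ⟨w, t, c', h, hw, hc⟩ := ih (N.exec (N.tm.m l) c) u.tail
      refine ⟨false :: w, t + 1, c', .guess0 hl ha h, ?_, hc.imp_right fun e => by rw [e]⟩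
      rw [List.length_cons, List.takeD_succ, hw, ← hu]
      cases u <;> rfl
    · obtain ⟨w, t, c', h, hw, hc⟩ := ih (N.exec s c) u.tail
      refine ⟨true :: w, t + 1, c', .guess1 hl ha h, ?_, hc.imp_right fun e => by rw [e]⟩
      rw [List.length_cons, List.takeD_succ, hw, ← hu]
      cases u <;> rfl

variable {N}

theorem Run.unique {c c₁ c₂ : N.tm.Cfg} {w : Str} {t₁ t₂ : ℕ} (h₁ : N.Run c w t₁ c₁)
    (h₂ : N.Run c w t₂ c₂) (e₁ : c₁.l = none) (e₂ : c₂.l = none) : c₁ = c₂ := by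
  induction h₁ generalizing t₂ with
  | refl =>
    cases h₂ with
    | refl => rfl
    | det hl => rw [e₁] at hl; cases hl
  | det hl ha _ ih =>
    cases h₂ with
    | refl => rw [e₂] at hl; cases hl
    | det hl' ha' h => obtain rfl := Option.some_injective _ (hl.symm.trans hl'); exact ih h e₁
    | guess0 hl' ha' h =>
      obtain rfl := Option.some_injective _ (hl.symm.trans hl'); rw [ha] at ha'; cases ha'
    | guess1 hl' ha' h =>
      obtain rfl := Option.some_injective _ (hl.symm.trans hl'); rw [ha] at ha'; cases ha'
  | guess0 hl ha _ ih =>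
    cases h₂ with
    | det hl' ha' h =>
      obtain rfl := Option.some_injective _ (hl.symm.trans hl'); rw [ha] at ha'; cases ha'
    | guess0 hl' ha' h => obtain rfl := Option.some_injective _ (hl.symm.trans hl'); exact ih h e₁
  | guess1 hl ha _ ih =>
    cases h₂ with
    | det hl' ha' h =>
      obtain rfl := Option.some_injective _ (hl.symm.trans hl'); rw [ha] at ha'; cases ha'
    | guess1 hl' ha' h =>
      obtain rfl := Option.some_injective _ (hl.symm.trans hl')
      obtain rfl := Option.some_injective _ (ha.symm.trans ha')
      exact ih h e₁

variable (N)

/-- The stacks of the simulator: two stacks for pairs of strings, a stack for the guesses to make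
and a stack for the output, and the stacks of the machine. -/
abbrev simΓ : (Bool ⊕ Bool) ⊕ N.tm.K → Type :=
  Sum.elim (Sum.elim (fun _ => Bool ⊕ Bool) (fun _ => Bool)) N.tm.Γ

/-- The translation of a statement in the simulator. -/
def simStmt (q : TM2.Stmt N.tm.Γ N.tm.Λ N.tm.σ) :
    TM2.Stmt N.simΓ N.tm.Λ (N.tm.σ × Bool) :=
  tr (Γ' := N.simΓ) .inr Prod.fst (fun a v => (a, v.2)) id
    (.push (.inl (.inr true)) (fun v => N.accept v.1) .halt) q

/-- The simulator takes the guesses from a stack (and guesses `0` when this is empty), records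
them, and records at the end whether the machine accepts. -/
def sim : Prog ((Bool ⊕ Bool) ⊕ N.tm.K) N.simΓ where
  Λ := N.tm.Λ
  σ := N.tm.σ × Bool
  main := N.tm.main
  init := (N.tm.initialState, false)
  m l := (N.alt l).elim (N.simStmt (N.tm.m l)) fun s =>
    .pop (.inl (.inr false)) (fun v o => (v.1, Option.getD o false)) <|
    .push (.inl (.inr true)) (fun v => v.2) <|
    .branch Prod.snd (N.simStmt s) (N.simStmt (N.tm.m l))

/-- The stacks of the simulator, when `u` are the guesses to make and `r` is the output. -/
def simStk (u r : Str) (S : ∀ k, List (N.tm.Γ k)) : ∀ k, List (N.simΓ k)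
  | .inl (.inl _) => []
  | .inl (.inr false) => u
  | .inl (.inr true) => r
  | .inr k => S k

/-- The configuration of the simulator. -/
def simCfg (c : TM2.Cfg N.tm.Γ N.tm.Λ N.tm.σ) (b : Bool) (u r : Str) :
    TM2.Cfg N.simΓ N.tm.Λ (N.tm.σ × Bool) :=
  match c.l with
  | some l => ⟨some l, (c.var, b), N.simStk u r c.stk⟩
  | none => ⟨none, (c.var, b), N.simStk u (N.accept c.var :: r) c.stk⟩

theorem simStk_push (u r r' : Str) (S : ∀ k, List (N.tm.Γ k)) :
    update (N.simStk u r S) (.inl (.inr true)) r' = N.simStk u r' S := by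
  funext k
  rcases k with ((_ | _) | (_ | _)) | k <;> rfl

theorem stepAux_simStmt (q : TM2.Stmt N.tm.Γ N.tm.Λ N.tm.σ) (v : N.tm.σ)
    (S : ∀ k, List (N.tm.Γ k)) (b : Bool) (u r : Str) :
    TM2.stepAux (N.simStmt q) (v, b) (N.simStk u r S) =
      N.simCfg (TM2.stepAux q v S) b u r := by
  generalize hc : TM2.stepAux q v S = c
  obtain ⟨T, h1, h2, h3⟩ := exists_stepAux_tr (Γ' := N.simΓ) (ι := Sum.inr) Sum.inr_injective
    (g := Prod.fst) (p := fun a v => (a, v.2)) (fun _ _ => rfl) (fun _ _ _ => rfl)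
    (fun _ => rfl) id (.push (.inl (.inr true)) (fun v => N.accept v.1) .halt) q (v, b)
    (N.simStk u r S) (c := c) hc
  have hT : T = N.simStk u r c.stk := by
    funext k
    rcases k with k | k
    · rw [h2 _ (by simp)]
      rcases k with (_ | _) | (_ | _) <;> rfl
    · exact congrFun h1 k
  subst hT
  refine h3.trans ?_
  rcases c with ⟨_ | l, v', S'⟩
  · exact congrArg (TM2.Cfg.mk none (v', b)) (N.simStk_push u r (N.accept v' :: r) S')
  · rfl

theorem stepAux_sim_det {l : N.tm.Λ} (ha : N.alt l = none) (v : N.tm.σ)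
    (S : ∀ k, List (N.tm.Γ k)) (b : Bool) (u r : Str) :
    TM2.stepAux (N.sim.m l) (v, b) (N.simStk u r S) =
      N.simCfg (TM2.stepAux (N.tm.m l) v S) b u r := by
  have : N.sim.m l = N.simStmt (N.tm.m l) := by simp [sim, ha]
  exact (congrArg (fun q => TM2.stepAux q (v, b) (N.simStk u r S)) this).trans
    (N.stepAux_simStmt (N.tm.m l) v S b u r)

theorem stepAux_sim_guess {l : N.tm.Λ} {s : TM2.Stmt N.tm.Γ N.tm.Λ N.tm.σ}
    (ha : N.alt l = some s) (v : N.tm.σ) (S : ∀ k, List (N.tm.Γ k)) (b : Bool) (u r : Str) :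
    TM2.stepAux (N.sim.m l) (v, b) (N.simStk u r S) =
      N.simCfg (TM2.stepAux (bif u.headD false then s else N.tm.m l) v S) (u.headD false) u.tail
        (u.headD false :: r) := by
  have h₁ : N.sim.m l = .pop (.inl (.inr false)) (fun v o => (v.1, Option.getD o false))
      (.push (.inl (.inr true)) (fun v => v.2)
        (.branch Prod.snd (N.simStmt s) (N.simStmt (N.tm.m l)))) := by simp only [sim, ha]; rfl
  have h₂ : ∀ q, N.simStk u.tail (q :: r) S = update (update (N.simStk u r S)
      (.inl (.inr false)) u.tail) (.inl (.inr true)) (q :: r) := fun q => by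
    funext k
    rcases k with ((_ | _) | (_ | _)) | k <;> rfl
  have h₃ : TM2.stepAux (N.sim.m l) (v, b) (N.simStk u r S) =
      bif u.headD false then
        TM2.stepAux (N.simStmt s) (v, u.headD false) (N.simStk u.tail (u.headD false :: r) S)
      else TM2.stepAux (N.simStmt (N.tm.m l)) (v, u.headD false)
          (N.simStk u.tail (u.headD false :: r) S) := by
    refine (congrArg (fun q => TM2.stepAux q (v, b) (N.simStk u r S)) h₁).trans ?_
    rw [h₂]
    cases u <;> rfl
  rw [h₃]
  cases u.headD false
  · exact N.stepAux_simStmt _ _ _ _ _ _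
  · exact N.stepAux_simStmt _ _ _ _ _ _

/-- The simulation is step by step, with the guesses made so far in reverse order on the output
stack, on top of `r`. -/
theorem Run.stepsTo {N : NTM} {c c' : N.tm.Cfg} {w : Str} {t : ℕ} (h : N.Run c w t c')
    (u : Str) (hu : u.takeD w.length false = w) (b : Bool) (r : Str) :
    ∃ b' u', StepsTo N.sim.m t (N.simCfg c b u r) (N.simCfg c' b' u' (w.reverse ++ r)) := by
  have step : ∀ {c d : TM2.Cfg N.tm.Γ N.tm.Λ N.tm.σ} {l : N.tm.Λ} {b u r b' u' r' t e},
      c.l = some l →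
      TM2.stepAux (N.sim.m l) (c.var, b) (N.simStk u r c.stk) = N.simCfg d b' u' r' →
      StepsTo N.sim.m t (N.simCfg d b' u' r') e →
      StepsTo N.sim.m (t + 1) (N.simCfg c b u r) e := by
    rintro ⟨_, v, S⟩ d l b u r b' u' r' t e ⟨⟩ hs h
    exact .step (hs ▸ h)
  have head : ∀ {u : Str} {a : Bool} {w : Str}, u.takeD (a :: w).length false = a :: w →
      u.headD false = a ∧ u.tail.takeD w.length false = w := by
    intro u a w h
    rw [List.length_cons, List.takeD_succ, List.cons.injEq] at h
    refine ⟨?_, h.2⟩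
    rw [← h.1]
    cases u <;> rfl
  induction h generalizing u b r with
  | refl c => exact ⟨b, u, .refl _⟩
  | det hl ha h ih =>
    obtain ⟨b', u', h'⟩ := ih u hu b r
    exact ⟨b', u', step hl (N.stepAux_sim_det ha _ _ b u r) h'⟩
  | guess0 hl ha h ih =>
    obtain ⟨e, hu⟩ := head hu
    obtain ⟨b', u', h'⟩ := ih u.tail hu false (false :: r)
    have hs := fun v S => N.stepAux_sim_guess ha v S b u r
    rw [e] at hs
    rw [List.reverse_cons, List.append_assoc]
    exact ⟨b', u', step hl (hs _ _) h'⟩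
  | guess1 hl ha h ih =>
    obtain ⟨e, hu⟩ := head hu
    obtain ⟨b', u', h'⟩ := ih u.tail hu true (true :: r)
    have hs := fun v S => N.stepAux_sim_guess ha v S b u r
    rw [e] at hs
    rw [List.reverse_cons, List.append_assoc]
    exact ⟨b', u', step hl (hs _ _) h'⟩

end NTM

end ClusterComputing

namespace ClusterComputing

open Turing Function Computability

namespace NTM

/-- Given the first guesses, a polynomial-time machine can be simulated deterministically. The
simulator outputs whether the path accepts, followed by the guesses in the reverse order. -/
theorem exists_simulation {N : NTM} {p : Polynomial ℕ} (hp : N.PolyTime) (hb : N.Balanced p) :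
    ∃ out : Str × Str → Str, PolyFn (encPair encStr encStr) encStr out ∧
      (∀ x, ∀ w ∈ strs (p.eval x.length), ((out (x, w)).headD false = true ↔ w ∈ N.acc x)) ∧
      ∀ x, (out (x, [])).tail = List.replicate (p.eval x.length) false := by
  obtain ⟨q, hq⟩ := hp
  have hrun : ∀ y : Str × Str, ∃ w t c', N.Run (N.init y.1) w t c' ∧
      y.2.takeD w.length false = w ∧ c'.l = none := by
    rintro ⟨x, u⟩
    -- One step more than the machine can make, so the run must halt.
    obtain ⟨w, t, c', h, hw, hc⟩ := N.exists_run (q.eval x.length + 1) (N.init x) u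
    refine ⟨w, t, c', h, hw, hc.resolve_right ?_⟩
    rintro rfl
    exact absurd (hq x w _ c' h) (by omega)
  choose w t c h hw hc using hrun
  have hlen : ∀ y, (w y).length = p.eval y.1.length := fun y => by
    have : w y ∈ N.paths y.1 := ⟨t y, c y, h y, hc y⟩
    rw [hb] at this
    exact this
  refine ⟨fun y => N.accept (c y).var :: (w y).reverse, ?_, ?_, ?_⟩
  · let a : (Bool ⊕ Bool) ⊕ N.tm.K := .inl (.inl false)
    let b : (Bool ⊕ Bool) ⊕ N.tm.K := .inl (.inl true)
    let g : (Bool ⊕ Bool) ⊕ N.tm.K := .inl (.inr false)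
    let o : (Bool ⊕ Bool) ⊕ N.tm.K := .inl (.inr true)
    have iBB : Fintype (Bool ⊕ Bool) := inferInstance
    let _ : ∀ b, Fintype (N.simΓ (.inl (.inl b))) := fun _ => iBB
    let F₁ : Prog _ N.simΓ := Prog.moveTo (Γ := N.simΓ) a b id
    let F₂ : Prog _ N.simΓ := Prog.copyTo (Γ := N.simΓ) b (.inr N.tm.k₀) g
      (fun s => (Sum.getLeft? s).map N.inputAlphabet.symm) Sum.getRight?
    -- The machine may halt with arbitrary stacks; `C` bounds their heights, and thus the time for
    -- erasing them.
    obtain ⟨C, hC⟩ := exists_pushes_le N.sim.m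
    refine PolyFn.of_prog (((F₁.seq F₂).seq N.sim).seq (Prog.erase o)) (k₀ := a) (k₁ := o)
      (Equiv.refl (Bool ⊕ Bool)) (Equiv.refl Bool) ((Polynomial.X + 1) + (Polynomial.X + 1) + q +
        (Polynomial.X + Polynomial.C C * q + 1)) fun y => ?_
    have hy : (encPair encStr encStr y).length = y.1.length + y.2.length := by simp [encPair]
    have hyq : q.eval y.1.length ≤ q.eval (encPair encStr encStr y).length :=
      eval_mono q (by omega)
    have r₁ := Prog.runs_moveTo_single (Γ := N.simΓ) (a := a) (b := b) (g := id)
      (l := encPair encStr encStr y) (l' := (encPair encStr encStr y).reverse)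
      (by simp [a, b]) (congrArg List.reverse (List.map_id _)) (List.length_reverse).le
    have r₂ := Prog.runs_copyTo (Γ := N.simΓ) (a := b) (b := .inr N.tm.k₀) (c := g)
      (g := fun s => (Sum.getLeft? s).map N.inputAlphabet.symm) (g' := Sum.getRight?)
      (l := (encPair encStr encStr y).reverse) (l₁ := y.1.map N.inputAlphabet.symm)
      (l₂ := y.2) (n := (encPair encStr encStr y).length)
      (by simp [b]) (by simp [b, g]) (by simp [g])
      (by
        have : ((encPair encStr encStr y).reverse.filterMap
            fun s => (Sum.getLeft? s).map N.inputAlphabet.symm).reverse =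
            y.1.map N.inputAlphabet.symm := by
          simp [encPair, List.filterMap_append, List.filterMap_map, Function.comp_def,
            ← List.map_reverse]
        exact this)
      (by
        have : ((encPair encStr encStr y).reverse.filterMap Sum.getRight?).reverse = y.2 := by
          simp [encPair, List.filterMap_append, List.filterMap_map, Function.comp_def,
            ← List.map_reverse]
        exact this)
      (List.length_reverse).le
    obtain ⟨b', u', hs⟩ := (h y).stepsTo y.2 (hw y) false []
    have e₁ : N.simCfg (N.init y.1) false y.2 [] = ⟨some N.sim.main, N.sim.init,
        double (Γ := N.simΓ) (.inr N.tm.k₀) (y.1.map N.inputAlphabet.symm) g y.2⟩ := by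
      have : N.init y.1 = ⟨some N.tm.main, N.tm.initialState,
        single N.tm.k₀ (y.1.map N.inputAlphabet.symm)⟩ := Prog.initList_eq _ _
      rw [this]
      refine congrArg (TM2.Cfg.mk (some N.tm.main) (N.tm.initialState, false)) ?_
      funext k
      rcases k with ((_ | _) | (_ | _)) | k
      · rfl
      · rfl
      · rfl
      · rfl
      · exact (congrFun (double_comp (Γ' := N.simΓ) (ι := Sum.inr) Sum.inr_injective N.tm.k₀
          (y.1.map N.inputAlphabet.symm) (k' := g) (by simp [g]) y.2) k).symm
    have e₂ : N.simCfg (c y) b' u' ((w y).reverse ++ []) = ⟨none, ((c y).var, b'),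
        N.simStk u' (N.accept (c y).var :: (w y).reverse) (c y).stk⟩ := by
      rw [List.append_nil]
      unfold simCfg
      split
      · next l hl => exact absurd (hl.symm.trans (hc y)) (by simp)
      · rfl
    rw [e₁, e₂] at hs
    have r₃ : N.sim.Runs _ _ _ := ⟨t y, (hq _ _ _ _ (h y)).trans hyq, _, hs⟩
    have r₄ := Prog.runs_erase (k₁ := o) (S := N.simStk u'
        (N.accept (c y).var :: (w y).reverse) (c y).stk)
        (B := (encPair encStr encStr y).length +
          C * q.eval (encPair encStr encStr y).length) (fun k => by
      refine (r₃.length_le hC k).trans (Nat.add_le_add_right ?_ _)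
      refine (length_double_le (Γ := N.simΓ) (.inr N.tm.k₀) (y.1.map N.inputAlphabet.symm) g y.2
        k).trans (le_of_eq ?_)
      rw [hy]
      exact congrArg (· + y.2.length) (List.length_map _))
    refine ⟨_, _, List.map_id _, List.map_id _, (((r₁.seq r₂).seq r₃).seq r₄).mono (le_of_eq ?_)⟩
    simp only [Polynomial.eval_add, Polynomial.eval_one, Polynomial.eval_X, Polynomial.eval_mul,
      Polynomial.eval_C]
    rfl
  · intro x u hu
    have hwu : w (x, u) = u := by
      have h1 := hw (x, u)
      have h2 : (w (x, u)).length = u.length := (hlen (x, u)).trans hu.symm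
      rw [h2] at h1
      rw [← h1]
      simp [List.takeD_eq_take]
    change N.accept (c (x, u)).var = true ↔ _
    constructor
    · intro ha
      exact ⟨t (x, u), c (x, u), by simpa only [hwu] using h (x, u), hc _, ha⟩
    · rintro ⟨t', c', h', hc', ha⟩
      have h1 := h (x, u)
      rw [hwu] at h1
      rw [h1.unique h' (hc _) hc']
      exact ha
  · intro x
    -- Without prescribed guesses, all guesses are `0`, and balance gives their number.
    have h1 := hw (x, [])
    rw [hlen, List.takeD_nil] at h1
    change (w (x, [])).reverse = _
    rw [← h1, List.reverse_replicate]

end NTM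

end ClusterComputing

namespace ClusterComputing

open Turing Function Computability

/-! ### Padding a machine with a guess that must be `0` -/

namespace NTM

variable (N : NTM)

/-- The translation of a statement in the padded machine. -/
def padStmt (q : TM2.Stmt N.tm.Γ N.tm.Λ N.tm.σ) :
    TM2.Stmt N.tm.Γ (Option N.tm.Λ) (N.tm.σ × Bool) :=
  tr (Γ' := N.tm.Γ) id Prod.fst (fun a v => (a, v.2)) some .halt q

/-- The machine that first guesses a bit, then runs `N`, and accepts if the bit was `0` and `N`
accepts. -/
def pad : NTM where
  tm :=
    { K := N.tm.K
      k₀ := N.tm.k₀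
      k₁ := N.tm.k₁
      Γ := N.tm.Γ
      Λ := Option N.tm.Λ
      main := none
      σ := N.tm.σ × Bool
      initialState := (N.tm.initialState, true)
      Γk₀Fin := N.tm.Γk₀Fin
      m := fun l => l.elim (.goto fun _ => some N.tm.main) fun l => N.padStmt (N.tm.m l) }
  inputAlphabet := N.inputAlphabet
  alt l := l.elim (some (.load (fun v => (v.1, false)) (.goto fun _ => some N.tm.main)))
    fun l => (N.alt l).map N.padStmt
  accept v := N.accept v.1 && v.2

theorem pad_alt (l : N.tm.Λ) : N.pad.alt (some l) = (N.alt l).map N.padStmt := rfl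

/-- The configuration of the padded machine. -/
def padCfg (c : TM2.Cfg N.tm.Γ N.tm.Λ N.tm.σ) (b : Bool) : N.pad.tm.Cfg :=
  (⟨c.l.map some, (c.var, b), c.stk⟩ : TM2.Cfg N.tm.Γ (Option N.tm.Λ) (N.tm.σ × Bool))

theorem exec_padStmt (q : TM2.Stmt N.tm.Γ N.tm.Λ N.tm.σ) (c : TM2.Cfg N.tm.Γ N.tm.Λ N.tm.σ)
    (b : Bool) : N.pad.exec (N.padStmt q) (N.padCfg c b) = N.padCfg (N.exec q c) b := by
  change TM2.stepAux (N.padStmt q) (c.var, b) c.stk = N.padCfg (TM2.stepAux q c.var c.stk) b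
  generalize hd : TM2.stepAux q c.var c.stk = d
  obtain ⟨T, h1, h2, h3⟩ := exists_stepAux_tr (Γ' := N.tm.Γ) (ι := id) injective_id
    (g := Prod.fst) (p := fun a v => (a, v.2)) (fun _ _ => rfl) (fun _ _ _ => rfl)
    (fun _ => rfl) some .halt q (c.var, b) c.stk (c := d) hd
  obtain rfl : T = d.stk := h1
  refine h3.trans ?_
  rcases d with ⟨_ | l, v, S⟩ <;> rfl

variable {N}

theorem Run.pad {c c' : N.tm.Cfg} {w : Str} {t : ℕ} (h : N.Run c w t c') (b : Bool) :
    N.pad.Run (N.padCfg c b) w t (N.padCfg c' b) := by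
  have hl' : ∀ {c : N.tm.Cfg} {l}, c.l = some l → (N.padCfg c b).l = some (some l) :=
    fun hl => congrArg (Option.map some) hl
  induction h with
  | refl c => exact .refl _
  | @det c c' l w t hl ha _ ih =>
    refine .det (l := some l) (hl' hl) ((N.pad_alt l).trans (congrArg (Option.map N.padStmt) ha)) ?_
    exact (N.exec_padStmt (N.tm.m l) c b).symm ▸ ih
  | @guess0 c c' l s w t hl ha _ ih =>
    refine .guess0 (l := some l) (hl' hl) ((N.pad_alt l).trans (congrArg (Option.map N.padStmt) ha)) ?_
    exact (N.exec_padStmt (N.tm.m l) c b).symm ▸ ih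
  | @guess1 c c' l s w t hl ha _ ih =>
    refine .guess1 (l := some l) (hl' hl) ((N.pad_alt l).trans (congrArg (Option.map N.padStmt) ha)) ?_
    exact (N.exec_padStmt s c b).symm ▸ ih

theorem Run.of_pad {c : N.tm.Cfg} {d : N.pad.tm.Cfg} {w : Str} {t : ℕ} {b : Bool}
    (h : N.pad.Run (N.padCfg c b) w t d) : ∃ c', d = N.padCfg c' b ∧ N.Run c w t c' := by
  generalize he : N.padCfg c b = e at h
  have hl' : ∀ {c : N.tm.Cfg} {l}, (N.padCfg c b).l = some l → ∃ l', l = some l' ∧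
      c.l = some l' := by
    intro c l hl
    obtain ⟨l', h1, h2⟩ := Option.map_eq_some_iff.1 (show c.l.map some = some l from hl)
    exact ⟨l', h2.symm, h1⟩
  induction h generalizing c with
  | refl => exact ⟨c, he.symm, .refl _⟩
  | det hl ha _ ih =>
    subst he
    obtain ⟨l', rfl, e⟩ := hl' hl
    obtain ⟨c', rfl, k⟩ := ih (N.exec_padStmt (N.tm.m l') c b).symm
    exact ⟨c', rfl, .det e (Option.map_eq_none_iff.1 ha) k⟩
  | guess0 hl ha _ ih =>
    subst he
    obtain ⟨l', rfl, e⟩ := hl' hl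
    obtain ⟨c', rfl, k⟩ := ih (N.exec_padStmt (N.tm.m l') c b).symm
    obtain ⟨s', hs, -⟩ := Option.map_eq_some_iff.1 ha
    exact ⟨c', rfl, .guess0 e hs k⟩
  | guess1 hl ha _ ih =>
    subst he
    obtain ⟨l', rfl, e⟩ := hl' hl
    obtain ⟨s', hs, rfl⟩ := Option.map_eq_some_iff.1 ha
    obtain ⟨c', rfl, k⟩ := ih (N.exec_padStmt s' c b).symm
    exact ⟨c', rfl, .guess1 e hs k⟩

theorem init_eq (x : Str) : N.init x = (⟨some N.tm.main, N.tm.initialState,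
    single N.tm.k₀ (x.map N.inputAlphabet.symm)⟩ : TM2.Cfg N.tm.Γ N.tm.Λ N.tm.σ) :=
  Prog.initList_eq _ _

theorem pad_init_l (x : Str) : (N.pad.init x).l = some none := rfl

theorem pad_exec₀ (x : Str) :
    N.pad.exec (N.pad.tm.m none) (N.pad.init x) = N.padCfg (N.init x) true := by
  rw [init_eq, init_eq]
  rfl

theorem pad_exec₁ (x : Str) :
    N.pad.exec (.load (fun v => (v.1, false)) (.goto fun _ => some N.tm.main)) (N.pad.init x) =
      N.padCfg (N.init x) false := by
  rw [init_eq, init_eq]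
  rfl

/-- The first step of the padded machine only guesses `b` and stores `!b` as a flag; what follows is
a run of `N` that carries the flag along. -/
theorem pad_run_iff {x w : Str} {t : ℕ} {d : N.pad.tm.Cfg} :
    N.pad.Run (N.pad.init x) w t d ↔ (w = [] ∧ t = 0 ∧ d = N.pad.init x) ∨
      ∃ b w' t' c, w = b :: w' ∧ t = t' + 1 ∧ d = N.padCfg c (!b) ∧
        N.Run (N.init x) w' t' c := by
  constructor
  · intro h
    cases h with
    | refl => exact .inl ⟨rfl, rfl, rfl⟩
    | det hl ha _ => cases hl; cases ha
    | guess0 hl ha h =>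
      cases hl
      obtain ⟨c, rfl, k⟩ := Run.of_pad (b := true) ((pad_exec₀ x) ▸ h)
      exact .inr ⟨false, _, _, c, rfl, rfl, rfl, k⟩
    | guess1 hl ha h =>
      cases hl
      cases ha
      obtain ⟨c, rfl, k⟩ := Run.of_pad (b := false) ((pad_exec₁ x) ▸ h)
      exact .inr ⟨true, _, _, c, rfl, rfl, rfl, k⟩
  · rintro (⟨rfl, rfl, rfl⟩ | ⟨_ | _, w', t', c, rfl, rfl, rfl, h⟩)
    · exact .refl _
    · exact .guess0 (pad_init_l x) rfl ((pad_exec₀ x).symm ▸ h.pad true)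
    · exact .guess1 (pad_init_l x) rfl ((pad_exec₁ x).symm ▸ h.pad false)

theorem PolyTime.pad (h : N.PolyTime) : N.pad.PolyTime := by
  obtain ⟨q, hq⟩ := h
  refine ⟨q + 1, fun x w t c hr => ?_⟩
  rw [Polynomial.eval_add, Polynomial.eval_one]
  obtain ⟨-, rfl, -⟩ | ⟨b, w', t', c', -, rfl, -, hr⟩ := pad_run_iff.1 hr
  · exact Nat.zero_le _
  · exact Nat.succ_le_succ (hq _ _ _ _ hr)

theorem padCfg_l_eq_none {c : N.tm.Cfg} {b : Bool} : (N.padCfg c b).l = none ↔ c.l = none :=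
  Option.map_eq_none_iff (x := c.l) (f := some)

theorem Balanced.pad {p : Polynomial ℕ} (h : N.Balanced p) : N.pad.Balanced (p + 1) := by
  intro x
  ext w
  rw [Polynomial.eval_add, Polynomial.eval_one]
  constructor
  · rintro ⟨t, c, hr, hc⟩
    obtain ⟨-, -, rfl⟩ | ⟨b, w', t', c', rfl, rfl, rfl, k⟩ := pad_run_iff.1 hr
    · rw [pad_init_l] at hc; cases hc
    · have : w' ∈ N.paths x := ⟨t', c', k, padCfg_l_eq_none.1 hc⟩
      rw [h] at this
      exact congrArg (· + 1) this
  · intro hw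
    rcases w with _ | ⟨b, w'⟩
    · cases hw
    · have hw' : w' ∈ strs (p.eval x.length) := Nat.succ_injective hw
      rw [← h] at hw'
      obtain ⟨t', c', hr, hc⟩ := hw'
      exact ⟨t' + 1, N.padCfg c' (!b), pad_run_iff.2 (.inr ⟨b, w', t', c', rfl, rfl, rfl, hr⟩),
        padCfg_l_eq_none.2 hc⟩

theorem acc_pad (x : Str) : N.pad.acc x = List.cons false '' N.acc x := by
  ext w
  constructor
  · rintro ⟨t, c, hr, hc, ha⟩
    obtain ⟨-, -, rfl⟩ | ⟨b, w', t', c', rfl, rfl, rfl, k⟩ := pad_run_iff.1 hr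
    · rw [pad_init_l] at hc; cases hc
    · obtain ⟨h1, h2⟩ := Bool.and_eq_true_iff.1
        (show (N.accept c'.var && !b) = true from ha)
      obtain rfl : b = false := by simpa using h2
      exact ⟨w', ⟨t', c', k, padCfg_l_eq_none.1 hc, h1⟩, rfl⟩
  · rintro ⟨w', ⟨t', c', hr, hc, ha⟩, rfl⟩
    exact ⟨t' + 1, N.padCfg c' true,
      pad_run_iff.2 (.inr ⟨false, w', t', c', rfl, rfl, rfl, hr⟩), padCfg_l_eq_none.2 hc,
      Bool.and_eq_true_iff.2 ⟨ha, rfl⟩⟩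

theorem acc_subset {p : Polynomial ℕ} (h : N.Balanced p) (x : Str) :
    N.acc x ⊆ strs (p.eval x.length) := by
  rintro w ⟨t, c, hr, hc, -⟩
  rw [← h]
  exact ⟨t, c, hr, hc⟩

end NTM

end ClusterComputing

namespace ClusterComputing

/-! ### Strings as binary numbers -/

/-- The number whose binary representation is the given string. -/
def val : Str → ℕ
  | [] => 0
  | b :: w => (bif b then 2 ^ w.length else 0) + val w

/-- The string of length `n` that represents the number `k`. -/
def bits : ℕ → ℕ → Str
  | 0, _ => []
  | n + 1, k => if 2 ^ n ≤ k then true :: bits n (k - 2 ^ n) else false :: bits n k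

theorem val_lt (w : Str) : val w < 2 ^ w.length := by
  induction w with
  | nil => simp [val]
  | cons b w ih =>
    rw [val, List.length_cons, pow_succ]
    cases b <;> simp <;> omega

theorem length_bits (n k : ℕ) : (bits n k).length = n := by
  induction n generalizing k with
  | zero => rfl
  | succ n ih => rw [bits]; split_ifs <;> simp [ih]

theorem val_bits {n k : ℕ} (h : k < 2 ^ n) : val (bits n k) = k := by
  induction n generalizing k with
  | zero => simp at h; simp [bits, val, h]
  | succ n ih =>
    rw [pow_succ] at h
    rw [bits]
    split_ifs with hk
    · rw [val, ih (by omega), length_bits]; simp; omega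
    · rw [val, ih (by omega)]; simp

theorem lex_iff_val_lt {a b : Str} (h : a.length = b.length) :
    List.Lex (· < ·) a b ↔ val a < val b := by
  induction a generalizing b with
  | nil =>
    obtain rfl : b = [] := List.eq_nil_of_length_eq_zero h.symm
    simp
  | cons x a ih =>
    rcases b with _ | ⟨y, b⟩
    · cases h
    · have hab : a.length = b.length := Nat.succ_injective h
      have h1 := val_lt a
      have h2 := val_lt b
      rw [hab] at h1
      rw [List.cons_lex_cons_iff, ih hab, val, val, hab]
      cases x <;> cases y <;> simp [Bool.lt_iff] <;> omega

theorem lexLT_iff {a b : Str} (h : a.length = b.length) : lexLT a b ↔ val a < val b := by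
  rw [lexLT, List.shortlex_iff_lex h, lex_iff_val_lt h]

theorem val_injective {a b : Str} (h : a.length = b.length) (hv : val a = val b) : a = b := by
  induction a generalizing b with
  | nil => exact (List.eq_nil_of_length_eq_zero h.symm).symm
  | cons x a ih =>
    rcases b with _ | ⟨y, b⟩
    · cases h
    · have hab : a.length = b.length := Nat.succ_injective h
      have h1 := val_lt a
      have h2 := val_lt b
      rw [val, val] at hv
      rw [hab] at h1 hv
      have hxy : x = y := by
        cases x <;> cases y <;> simp at hv ⊢ <;> omega
      subst hxy
      rw [ih hab (by omega)]

theorem lexLE_iff {a b : Str} (h : a.length = b.length) : lexLE a b ↔ val a ≤ val b := by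
  rw [lexLE, lexLT_iff h, le_iff_eq_or_lt]
  exact or_congr_left ⟨fun e => e ▸ rfl, val_injective h⟩

/-- A string that lies between two strings of the same length has this length too, so being an
immediate successor among all strings is decided within that length. -/
theorem lexSucc_iff {a b : Str} (h : a.length = b.length) :
    lexSucc a b ↔ val b = val a + 1 := by
  rw [lexSucc, lexLT_iff h]
  constructor
  · rintro ⟨h1, h2⟩
    by_contra hne
    have hlt : val a + 1 < 2 ^ a.length := by
      have := val_lt b
      rw [← h] at this
      omega
    refine h2 ⟨bits a.length (val a + 1), ?_, ?_⟩
    · rw [lexLT_iff (length_bits _ _).symm, val_bits hlt]; omega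
    · rw [lexLT_iff ((length_bits _ _).trans h), val_bits hlt]; omega
  · intro h1
    refine ⟨by omega, ?_⟩
    rintro ⟨c, h2, h3⟩
    have hc : c.length = a.length := by
      rw [lexLT, List.shortlex_def] at h2 h3
      omega
    rw [lexLT_iff hc.symm] at h2
    rw [lexLT_iff (hc.trans h)] at h3
    omega

theorem val_replicate_false (n : ℕ) : val (List.replicate n false) = 0 := by
  induction n with
  | zero => rfl
  | succ n ih => rw [List.replicate_succ, val, ih]; rfl

theorem val_replicate_true (n : ℕ) : val (List.replicate n true) = 2 ^ n - 1 := by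
  induction n with
  | zero => rfl
  | succ n ih =>
    rw [List.replicate_succ, val, ih, List.length_replicate, pow_succ]
    have := Nat.one_le_two_pow (n := n)
    simp; omega

theorem mem_strs {n : ℕ} {w : Str} : w ∈ strs n ↔ w.length = n := Iff.rfl

theorem bijOn_val (n : ℕ) : Set.BijOn val (strs n) (Set.Iio (2 ^ n)) :=
  ⟨fun w hw => by have := val_lt w; rwa [mem_strs.1 hw] at this,
    fun a ha b hb h => val_injective (ha.trans hb.symm) h,
    fun k hk => ⟨bits n k, length_bits n k, val_bits hk⟩⟩

theorem finite_strs (n : ℕ) : (strs n).Finite :=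
  (bijOn_val n).finite_iff_finite.2 (Set.finite_Iio _)

theorem ncard_strs (n : ℕ) : (strs n).ncard = 2 ^ n := by
  rw [(bijOn_val n).ncard_eq, Set.ncard_eq_toFinset_card']
  simp

end ClusterComputing

namespace ClusterComputing

open Turing Function Computability

/-! ### Boolean combinations, and the inclusion of `CLU#P` in the circular class -/

section Combinators

variable {α A : Type} {ea : α → List A} [Fintype A]

/-- Shannon expansion with respect to the first argument. -/
theorem PolyFn.boolFn {m : ℕ} (op : (Fin m → Bool) → Bool) {f : Fin m → α → Bool}
    (hf : ∀ i, PolyFn ea encodeBool (f i)) :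
    PolyFn ea encodeBool (fun a => op fun i => f i a) := by
  induction m with
  | zero =>
    refine .automaton (Q := Unit) () (fun _ _ => ()) (fun _ => op Fin.elim0) fun a => ?_
    exact congrArg op (Subsingleton.elim _ _)
  | succ m ih =>
    have h1 := (hf 0).bool₂ (fun x y => x && y) (ih (fun v => op (Fin.cons true v))
      fun i => hf i.succ)
    have h0 := (hf 0).bool₂ (fun x y => !x && y) (ih (fun v => op (Fin.cons false v))
      fun i => hf i.succ)
    convert h1.bool₂ (fun x y => x || y) h0 using 2 with a
    have : (fun i => f i a) = Fin.cons (f 0 a) fun i : Fin m => f i.succ a :=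
      (Fin.cons_self_tail fun i => f i a).symm
    rw [this]
    cases f 0 a <;> simp

theorem PolyFn.nil : PolyFn ea encStr (fun _ => ([] : Str)) :=
  .filterMap (fun _ => none) fun a => by simp

theorem PolyFn.id : PolyFn ea ea (fun a => a) :=
  .filterMap some fun a => by simp

open Classical in
theorem PolyTimePred₃.polyFn {R : Str → Str → Str → Prop} (hR : PolyTimePred₃ R)
    {f g k : α → Str} (hf : PolyFn ea encStr f) (hg : PolyFn ea encStr g)
    (hk : PolyFn ea encStr k) :
    PolyFn ea encodeBool (fun a => decide (R (f a) (g a) (k a))) := by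
  have h : PolyFn (encPair encStr (encPair encStr encStr)) encodeBool
    (fun t : Str × Str × Str => decide (R t.1 t.2.1 t.2.2)) := hR
  exact h.comp (hf.pair (hg.pair hk))

end Combinators

open Classical in
theorem polyTimePred₃_of_polyFn {R : Str → Str → Str → Prop} {g : Str × Str × Str → Bool}
    (hg : PolyFn (encPair encStr (encPair encStr encStr)) encodeBool g)
    (h : ∀ x y z, g (x, y, z) = true ↔ R x y z) : PolyTimePred₃ R := by
  have e : g = fun t : Str × Str × Str => decide (R t.1 t.2.1 t.2.2) := by
    funext ⟨x, y, z⟩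
    rw [Bool.eq_iff_iff, h, decide_eq_true_iff]
  rw [e] at hg
  exact hg

open Classical in
theorem inP_of_polyFn {L : Set Str} {g : Str → Bool} (hg : PolyFn encStr encodeBool g)
    (h : ∀ x, g x = true ↔ x ∈ L) : InP L := by
  have e : g = fun x : Str => decide (x ∈ L) := by
    funext x
    rw [Bool.eq_iff_iff, h, decide_eq_true_iff]
  rw [e] at hg
  exact hg

/-- The successor relation on `{0,1}^n`, closed up to a cycle, in terms of numbers. -/
theorem lexSucc_or_wrap_iff {n : ℕ} {y z : Str} (hy : y ∈ strs n) (hz : z ∈ strs n) :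
    (lexSucc y z ∨ (y = List.replicate n true ∧ z = List.replicate n false)) ↔
      val z = val y + 1 ∨ (val y + 1 = 2 ^ n ∧ val z = 0) := by
  have h1 : y = List.replicate n true ↔ val y + 1 = 2 ^ n := by
    have h := val_replicate_true n
    have h' := Nat.one_le_two_pow (n := n)
    refine ⟨fun e => by rw [e]; omega, fun e => val_injective (hy.trans ?_) (by omega)⟩
    simp
  have h2 : z = List.replicate n false ↔ val z = 0 := by
    have h := val_replicate_false n
    refine ⟨fun e => by rw [e]; omega, fun e => val_injective (hz.trans ?_) (by omega)⟩
    simp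
  rw [lexSucc_iff (hy.trans (Eq.symm hz)), h1, h2]

theorem eq_strs_of_ncard {n : ℕ} {A : Set Str} (hA : A ⊆ strs n) (h : A.ncard = 2 ^ n) :
    A = strs n :=
  Set.eq_of_subset_of_ncard_le hA (by rw [ncard_strs, h]) (finite_strs n)

/-- The same numbering `h` serves the circular witness, because `top x` and `b x` are the only
strings numbered `1^n` and `0^n`. -/
theorem CLUSharpP_subset : CLUSharpP ⊆ TildeCLUSharpPCircular := by
  rintro f ⟨p, M, b, top, prec, hM, hbal, hb, htop, hprec, H⟩
  obtain ⟨out, hout, hacc, -⟩ := M.exists_simulation hM hbal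
  have hb' : PolyFn encStr encStr b := hb
  have htop' : PolyFn encStr encStr top := htop
  have hx : PolyFn (encPair encStr (encPair encStr encStr)) encStr
      (fun t : Str × Str × Str => t.1) := .fst
  have hy : PolyFn (encPair encStr (encPair encStr encStr)) encStr
      (fun t : Str × Str × Str => t.2.1) := PolyFn.fst.comp .snd
  have hz : PolyFn (encPair encStr (encPair encStr encStr)) encStr
      (fun t : Str × Str × Str => t.2.2) := PolyFn.snd.comp .snd
  refine ⟨p, M, fun x y z => prec x y z ∨ (y = top x ∧ z = b x), ⟨hM, hbal, ?_, fun x => ?_⟩, ?_⟩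
  · refine polyTimePred₃_of_polyFn ((hprec.polyFn hx hy hz).bool₂ or
      ((hy.beq (htop'.comp hx)).bool₂ and (hz.beq (hb'.comp hx)))) fun x y z => ?_
    simp
  · obtain ⟨h, hh, hbl, htl, hbx, htx, hs, hc, hf⟩ := H x
    refine ⟨h, hh, fun y hy z hz => ?_, hc, hf⟩
    refine or_congr (hs y hy z hz) (and_congr ?_ ?_)
    · rw [← htx, hh.injOn.eq_iff hy htl]
    · rw [← hbx, hh.injOn.eq_iff hz hbl]
  -- The test for `f x = 2^n` asks whether the paths `b x` and `top x` both accept.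
  · refine inP_of_polyFn ((hout.comp (PolyFn.id.pair hb')).head.bool₂ and
      (hout.comp (PolyFn.id.pair htop')).head) fun x => ?_
    obtain ⟨h, hh, hbl, htl, hbx, htx, hs, hc, hf⟩ := H x
    rw [Bool.and_eq_true, hacc x _ hbl, hacc x _ htl, Set.mem_ofPred_eq]
    have hsub := NTM.acc_subset hbal x
    constructor
    · rintro ⟨h1, h2⟩
      -- The interval description of the accepting set is available only for `f x ≠ 0`; the
      -- accepting path `b x` provides this.
      have hfx : f x ≠ 0 := by
        rw [hf]
        exact Set.ncard_ne_zero_of_mem h1 ((finite_strs _).subset hsub)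
      obtain ⟨l, hl, u, hu, e⟩ := hc hfx
      have hL : ∀ w ∈ strs (p.eval x.length), (h w).length = p.eval x.length :=
        fun w hw => hh.mapsTo hw
      have h1' := (e ▸ h1 : b x ∈ {w | _}).2.1
      have h2' := (e ▸ h2 : top x ∈ {w | _}).2.2
      rw [lexLE_iff ((hL _ hl).trans (hL _ hbl).symm), hbx, val_replicate_false] at h1'
      rw [lexLE_iff ((hL _ htl).trans (hL _ hu).symm), htx, val_replicate_true] at h2'
      rw [hf, ← ncard_strs]
      congr 1
      refine hsub.antisymm fun w hw => ?_
      rw [e]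
      refine ⟨hw, ?_, ?_⟩
      · rw [lexLE_iff ((hL _ hl).trans (hL _ hw).symm)]; omega
      · rw [lexLE_iff ((hL _ hw).trans (hL _ hu).symm)]
        have := val_lt (h w)
        rw [hL _ hw] at this
        omega
    · intro e
      rw [eq_strs_of_ncard hsub (hf ▸ e)]
      exact ⟨hbl, htl⟩

end ClusterComputing

namespace ClusterComputing

open Turing Function Computability

/-! ### Cutting a cycle open

Four copies of a cycle of length `N`, each with a tag of two bits, are joined to one path. The
numbers on the cycle are counted from a given point, and the path leaves the first copy for the
second one, and the second one for the third one, behind the number `c`. -/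

/-- The position of the number `k` of the cycle on the path. -/
def tagPos (N c : ℕ) : Bool → Bool → ℕ → ℕ
  | false, true, k => if k ≤ c then k else k + 2 * N
  | false, false, k => if k ≤ c then k + N else k
  | true, true, k => if k ≤ c then k + 2 * N else k + N
  | true, false, k => 4 * N - 1 - k

/-- The successor relation of the path for two points `u` and `v` of the cycle. The first four
Booleans say whether `v` succeeds `u`, whether `u` succeeds `v`, whether `u = v`, and whether `u`
is the last point; the next two whether `u` and `v` are the first point; the last two whether the
cut is before the last point, and whether it is between `u` and `v`. -/
def tagNext (P Q E R Zu Zv B bd : Bool) : Bool → Bool → Bool → Bool → Bool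
  | false, true, false, true => P && !Zv && !bd
  | false, true, false, false => P && bd
  | false, false, false, false => P && !bd
  | false, false, true, true => P && bd
  | true, true, true, true => P && !bd
  -- If the cut edge leads to the first point, copy 01 has no remainder to return to.
  | true, true, false, true => P && bd && !Zv
  | true, false, true, false => Q && !Zu
  -- The turn into the reversed copy happens at the last point, coming from the remainder of copy 01
  -- if there is one (`B`), and from copy 11 otherwise.
  | false, true, true, false => E && R && B
  | true, true, true, false => E && R && !B
  | _, _, _, _ => false

theorem tagPos_lt {N c k : ℕ} (hk : k < N) (i j : Bool) : tagPos N c i j k < 4 * N := by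
  cases i <;> cases j <;> simp only [tagPos] <;> (try split_ifs) <;> omega

theorem tagPos_injective {N c k l : ℕ} (hk : k < N) (hl : l < N) {i j i' j' : Bool}
    (h : tagPos N c i j k = tagPos N c i' j' l) : i = i' ∧ j = j' ∧ k = l := by
  cases i <;> cases j <;> cases i' <;> cases j' <;> simp only [tagPos] at h <;>
    (try split_ifs at h) <;>
    simp only [true_and, reduceCtorEq, false_and] <;> omega

/-- For each combination of tags this is linear arithmetic. The condition on `bd` is required only
along edges of the cycle, since leaving `A` identifies the cut only there. -/
theorem tagNext_iff {N c k l : ℕ} (hk : k < N) (hl : l < N)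
    {P Q E R Zu Zv B bd : Bool} (hB : B = true → c + 1 < N) (hB' : B = false → c + 1 = N)
    (hP : P = true ↔ l = k + 1 ∨ (k + 1 = N ∧ l = 0))
    (hQ : Q = true ↔ k = l + 1 ∨ (l + 1 = N ∧ k = 0))
    (hE : E = true ↔ k = l) (hR : R = true ↔ k + 1 = N)
    (hZu : Zu = true ↔ k = 0) (hZv : Zv = true ↔ l = 0)
    (hbd : P = true → (bd = true ↔ k = c)) (i j i' j' : Bool) :
    tagNext P Q E R Zu Zv B bd i j i' j' = true ↔
      tagPos N c i' j' l = tagPos N c i j k + 1 := by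
  have hc : c < N := by
    cases B
    · have := hB' rfl; omega
    · have := hB rfl; omega
  have hBc : B = true ↔ c + 1 < N := by
    cases B
    · have := hB' rfl; simp only [reduceCtorEq, false_iff]; omega
    · have := hB rfl; simp only [true_iff]; omega
  clear hB hB'
  by_cases hP' : l = k + 1 ∨ (k + 1 = N ∧ l = 0)
  · have hP1 := hP.2 hP'
    have hb := hbd hP1
    cases i <;> cases j <;> cases i' <;> cases j' <;>
      simp only [tagPos, tagNext, Bool.and_eq_true, Bool.not_eq_true', ← Bool.not_eq_true,
        hP1, hb, hQ, hE, hR, hZu, hZv, hBc, true_and, Bool.false_eq_true, false_iff] <;>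
      (try split_ifs) <;> omega
  · have hP1 : ¬ P = true := fun h => hP' (hP.1 h)
    cases i <;> cases j <;> cases i' <;> cases j' <;>
      simp only [tagPos, tagNext, Bool.and_eq_true, Bool.not_eq_true', ← Bool.not_eq_true,
        hP1, hQ, hE, hR, hZu, hZv, hBc, false_and, Bool.false_eq_true, false_iff] <;>
      (try split_ifs) <;> omega

end ClusterComputing

/-! ### Numbering the cycle from a given point, and the choice of the cut -/

namespace ClusterComputing

open Turing Function Computability

/-- The number of `k` on a cycle of length `N`, counted from `z`. -/
def cycIdx (N z k : ℕ) : ℕ := if z ≤ k then k - z else k + N - z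

theorem cycIdx_lt {N z k : ℕ} (hz : z < N) (hk : k < N) : cycIdx N z k < N := by
  rw [cycIdx]; split_ifs <;> omega

theorem cycIdx_injective {N z k l : ℕ} (hz : z < N) (hk : k < N) (hl : l < N)
    (h : cycIdx N z k = cycIdx N z l) : k = l := by
  rw [cycIdx, cycIdx] at h
  split_ifs at h <;> omega

/-- A rotation preserves the cyclic successor relation, so the given predicate can be used for
numbers counted from `z`. -/
theorem cycIdx_succ_iff {N z k l : ℕ} (hz : z < N) (hk : k < N) (hl : l < N) :
    (cycIdx N z l = cycIdx N z k + 1 ∨ (cycIdx N z k + 1 = N ∧ cycIdx N z l = 0)) ↔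
      (l = k + 1 ∨ (k + 1 = N ∧ l = 0)) := by
  rw [cycIdx, cycIdx]
  split_ifs <;> omega

/-- If a set of numbers on a cycle is an interval, the cycle can be cut such that the set becomes
an interval of the path; `B` says whether the cut is at the end of the set. -/
theorem exists_cut {N z : ℕ} (hz : z < N) {A : ℕ → Prop}
    (hA : (∀ k < N, ¬ A k) ∨ ∃ lo hi, hi < N ∧ ∀ k < N, (A k ↔ lo ≤ k ∧ k ≤ hi))
    {B : Prop} (hB : B ↔ A z ∧ ¬ ∀ k < N, A k) :
    ∃ c, (B → c + 1 < N) ∧ (¬ B → c + 1 = N) ∧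
      (B → ∀ k < N, ∀ l < N, (cycIdx N z l = cycIdx N z k + 1 ∨
        (cycIdx N z k + 1 = N ∧ cycIdx N z l = 0)) → (A k ∧ ¬ A l ↔ cycIdx N z k = c)) ∧
      ((∃ k < N, A k) → ∃ a < 4 * N, ∃ b < 4 * N, ∀ k < N, ∀ i j : Bool,
        (a ≤ tagPos N c i j (cycIdx N z k) ∧ tagPos N c i j (cycIdx N z k) ≤ b ↔
          i = false ∧ j = false ∧ A k)) := by
  rcases hA with hA | ⟨lo, hi, hhi, hA⟩
  · have hB' : ¬ B := fun h => hA z hz (hB.1 h).1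
    exact ⟨N - 1, fun h => (hB' h).elim, fun _ => by omega, fun h => (hB' h).elim,
      fun ⟨k, hk, h⟩ => (hA k hk h).elim⟩
  by_cases hAll : ∀ k < N, A k
  · have hB' : ¬ B := fun h => (hB.1 h).2 hAll
    refine ⟨N - 1, fun h => (hB' h).elim, fun _ => by omega, fun h => (hB' h).elim,
      fun _ => ⟨N, by omega, 2 * N - 1, by omega, fun k hk i j => ?_⟩⟩
    have hk' := cycIdx_lt hz hk
    simp only [hAll k hk, and_true]
    cases i <;> cases j <;> simp only [tagPos] <;> (try split_ifs) <;>
      simp only [and_true, Bool.true_eq_false, and_false, iff_true, iff_false] <;> omega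
  by_cases hAz : A z
  · have hB' : B := hB.2 ⟨hAz, hAll⟩
    -- This gives `hi - z + 1 < N`: equality would force `z = 0`, hence `lo = 0`, and `hi = N - 1`.
    have hfull : ¬ (lo = 0 ∧ hi + 1 = N) := fun h => hAll fun k hk => (hA k hk).2 (by omega)
    have hz' := (hA z hz).1 hAz
    -- The cut is behind `hi`, whose number counted from `z` is `hi - z`. In copy 00 the part of `A`
    -- before `z` lies just below position `N`, and the rest starts at `N`.
    refine ⟨hi - z, fun _ => by omega, fun h => (h hB').elim, fun _ k hk l hl h => ?_,
      fun _ => ⟨N + lo - z, by omega, N + hi - z, by omega, fun k hk i j => ?_⟩⟩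
    · rw [hA k hk, hA l hl]
      rw [cycIdx, cycIdx] at h
      rw [cycIdx]
      split_ifs at h ⊢ <;> omega
    · have hk' := cycIdx_lt hz hk
      rw [hA k hk]
      cases i <;> cases j <;> simp only [tagPos, cycIdx] at hk' ⊢ <;> split_ifs at hk' ⊢ <;>
        simp only [true_and, and_false, false_and, iff_false] <;> omega
  · have hB' : ¬ B := fun h => hAz (hB.1 h).1
    have hz' := (hA z hz).not.1 hAz
    -- As `z` is not in `A`, cutting in front of `z` does not split `A`.
    refine ⟨N - 1, fun h => (hB' h).elim, fun _ => by omega, fun h => (hB' h).elim,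
      fun ⟨m, hm, hm'⟩ => ?_⟩
    have hm'' := (hA m hm).1 hm'
    refine ⟨N + cycIdx N z lo, ?_, N + cycIdx N z hi, ?_, fun k hk i j => ?_⟩
    · have := cycIdx_lt hz (k := lo) (by omega); omega
    · have := cycIdx_lt hz hhi; omega
    · have hk' := cycIdx_lt hz hk
      rw [hA k hk]
      cases i <;> cases j <;> simp only [tagPos, cycIdx] at hk' ⊢ <;> split_ifs at hk' ⊢ <;>
        simp only [true_and, and_false, false_and, iff_false] <;> omega

/-- The successor relation on the tagged strings `Y` and `Z`. -/
def nextStr (R : Str → Str → Bool) (A : Str → Bool) (S : Bool) (zero : Str) (Y Z : Str) : Bool :=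
  let u := Y.tail.tail
  let v := Z.tail.tail
  -- If all strings are accepted, no edge leaves the accepting set, and the cut has to be made at
  -- `zero` although `zero` is accepted.
  let B := A zero && !S
  tagNext (R u v) (R v u) (u == v) (R u zero) (u == zero) (v == zero) B
    (bif B then A u && !A v else v == zero)
    (Y.headD false) (Y.tail.headD false) (Z.headD false) (Z.tail.headD false)

theorem exists_tags {n : ℕ} {Y : Str} (hY : Y ∈ strs (n + 2)) :
    ∃ i j, ∃ u ∈ strs n, Y = i :: j :: u := by
  rcases Y with _ | ⟨i, _ | ⟨j, u⟩⟩
  · cases hY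
  · have := mem_strs.1 hY
    simp at this
  · exact ⟨i, j, u, Nat.succ_injective (Nat.succ_injective hY), rfl⟩

/-- The new numbering writes in binary the position of a tagged string on the path. It is an
injective map of a finite set to itself, hence a bijection, and its successor relation is given by
`tagNext_iff`. -/
theorem exists_path {n : ℕ} {h : Str → Str} (hh : Set.BijOn h (strs n) (strs n)) {zero : Str}
    (hzero : zero ∈ strs n) {A : Set Str} (hA : A ⊆ strs n)
    (hc : A.ncard ≠ 0 → Clustered n h A) {R : Str → Str → Bool}
    (hR : ∀ y ∈ strs n, ∀ z ∈ strs n, (R y z = true ↔ (lexSucc (h y) (h z) ∨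
      (h y = List.replicate n true ∧ h z = List.replicate n false))))
    {a : Str → Bool} (ha : ∀ w ∈ strs n, (a w = true ↔ w ∈ A)) {S : Bool}
    (hS : S = true ↔ A.ncard = 2 ^ n) :
    ∃ h' : Str → Str, Set.BijOn h' (strs (n + 2)) (strs (n + 2)) ∧
      h' (false :: true :: zero) = List.replicate (n + 2) false ∧
      h' (true :: false :: zero) = List.replicate (n + 2) true ∧
      (∀ Y ∈ strs (n + 2), ∀ Z ∈ strs (n + 2),
        (nextStr R a S zero Y Z = true ↔ lexSucc (h' Y) (h' Z))) ∧
      (A.ncard ≠ 0 → Clustered (n + 2) h' (List.cons false '' (List.cons false '' A))) := by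
  have hH := (bijOn_val n).comp hh
  have hfin := (finite_strs n).subset hA
  have hN : 2 ^ (n + 2) = 4 * 2 ^ n := by rw [pow_add, mul_comm]; norm_num
  have hlen : ∀ {w}, w ∈ strs n → (h w).length = n := fun hw => hh.mapsTo hw
  generalize hNe : 2 ^ n = N at *
  have hlt : ∀ {w}, w ∈ strs n → val (h w) < N := fun hw => hH.mapsTo hw
  have hinj : ∀ {u v}, u ∈ strs n → v ∈ strs n → val (h u) = val (h v) → u = v :=
    fun hu hv e => hH.injOn hu hv e
  have hsurj : ∀ k < N, ∃ w ∈ strs n, val (h w) = k := fun k hk => hH.surjOn hk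
  have hz := hlt hzero
  let A' : ℕ → Prop := fun k => ∃ w ∈ A, val (h w) = k
  have hA' : ∀ {w}, w ∈ strs n → (A' (val (h w)) ↔ w ∈ A) := fun hw =>
    ⟨fun ⟨w', hw', e⟩ => hinj (hA hw') hw e ▸ hw', fun hw' => ⟨_, hw', rfl⟩⟩
  have hall : (∀ k < N, A' k) ↔ S = true := by
    rw [hS]
    constructor
    · intro hk
      have e : A = strs n := hA.antisymm fun w hw => (hA' hw).1 (hk _ (hlt hw))
      rw [e, ncard_strs, hNe]
    · intro e k hk
      obtain ⟨w, hw, rfl⟩ := hsurj k hk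
      rw [hA' hw, eq_strs_of_ncard hA (e.trans hNe.symm)]
      exact hw
  have hint : (∀ k < N, ¬ A' k) ∨ ∃ lo hi, hi < N ∧ ∀ k < N, (A' k ↔ lo ≤ k ∧ k ≤ hi) := by
    by_cases h0 : A.ncard = 0
    · left
      rintro k - ⟨w, hw, -⟩
      exact Set.ncard_ne_zero_of_mem hw hfin h0
    · right
      obtain ⟨l, hl, u, hu, e⟩ := hc h0
      refine ⟨val (h l), val (h u), hlt hu, fun k hk => ?_⟩
      obtain ⟨w, hw, rfl⟩ := hsurj k hk
      have : w ∈ A ↔ w ∈ {w | w ∈ strs n ∧ lexLE (h l) (h w) ∧ lexLE (h w) (h u)} := by rw [← e]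
      rw [hA' hw, this, Set.mem_ofPred_eq, lexLE_iff ((hlen hl).trans (hlen hw).symm),
        lexLE_iff ((hlen hw).trans (hlen hu).symm), and_iff_right hw]
  have hBB : (a zero && !S) = true ↔ A' (val (h zero)) ∧ ¬ ∀ k < N, A' k := by
    rw [Bool.and_eq_true, Bool.not_eq_true', ← Bool.not_eq_true, hall, hA' hzero, ha _ hzero]
  obtain ⟨c, hc1, hc2, hc3, hc4⟩ := exists_cut hz hint hBB
  let idx : Str → ℕ := fun u => cycIdx N (val (h zero)) (val (h u))
  have hidx : ∀ {u}, u ∈ strs n → idx u < N := fun hu => cycIdx_lt hz (hlt hu)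
  have hidx0 : idx zero = 0 := by simp [idx, cycIdx]
  have hidxinj : ∀ {u v}, u ∈ strs n → v ∈ strs n → (u = v ↔ idx u = idx v) := fun hu hv =>
    ⟨fun e => e ▸ rfl, fun e => hinj hu hv (cycIdx_injective hz (hlt hu) (hlt hv) e)⟩
  have hRi : ∀ {u v}, u ∈ strs n → v ∈ strs n →
      (R u v = true ↔ idx v = idx u + 1 ∨ (idx u + 1 = N ∧ idx v = 0)) := fun hu hv => by
    rw [hR _ hu _ hv, lexSucc_or_wrap_iff (hh.mapsTo hu) (hh.mapsTo hv), hNe,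
      cycIdx_succ_iff hz (hlt hu) (hlt hv)]
  let pos : Str → ℕ := fun W =>
    tagPos N c (W.headD false) (W.tail.headD false) (idx W.tail.tail)
  let h' : Str → Str := fun W => bits (n + 2) (pos W)
  have hpos : ∀ W ∈ strs (n + 2), pos W < 4 * N := fun W hW => by
    obtain ⟨i, j, u, hu, rfl⟩ := exists_tags hW
    exact tagPos_lt (hidx hu) i j
  have hval : ∀ W ∈ strs (n + 2), val (h' W) = pos W := fun W hW =>
    val_bits (by rw [hN]; exact hpos W hW)
  have hlen' : ∀ W, (h' W).length = n + 2 := fun W => length_bits _ _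
  have hbij : Set.BijOn h' (strs (n + 2)) (strs (n + 2)) := by
    have hm : Set.MapsTo h' (strs (n + 2)) (strs (n + 2)) := fun W _ => hlen' W
    refine ((finite_strs (n + 2)).injOn_iff_bijOn_of_mapsTo hm).1 fun Y hY Z hZ e => ?_
    have e' : pos Y = pos Z := by rw [← hval Y hY, ← hval Z hZ, e]
    obtain ⟨i, j, u, hu, rfl⟩ := exists_tags hY
    obtain ⟨i', j', v, hv, rfl⟩ := exists_tags hZ
    obtain ⟨rfl, rfl, e''⟩ := tagPos_injective (hidx hu) (hidx hv) e'
    obtain rfl := (hidxinj hu hv).2 e''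
    rfl
  have hmem : ∀ i j, i :: j :: zero ∈ strs (n + 2) := fun i j =>
    mem_strs.2 (congrArg (· + 2) (mem_strs.1 hzero))
  refine ⟨h', hbij, ?_, ?_, fun Y hY Z hZ => ?_, fun h0 => ?_⟩
  · refine val_injective ((hlen' _).trans (by simp)) ?_
    rw [hval _ (hmem _ _), val_replicate_false]
    simp [pos, tagPos, hidx0]
  · refine val_injective ((hlen' _).trans (by simp)) ?_
    rw [hval _ (hmem _ _), val_replicate_true, hN]
    simp [pos, tagPos, hidx0]
  · rw [lexSucc_iff ((hlen' Y).trans (hlen' Z).symm), hval Y hY, hval Z hZ]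
    obtain ⟨i, j, u, hu, rfl⟩ := exists_tags hY
    obtain ⟨i', j', v, hv, rfl⟩ := exists_tags hZ
    refine tagNext_iff (hidx hu) (hidx hv) hc1 (fun e => hc2 (by simp [e])) (hRi hu hv)
      (hRi hv hu) (beq_iff_eq.trans (hidxinj hu hv)) ?_
      (beq_iff_eq.trans ?_) (beq_iff_eq.trans ?_) (fun hP => ?_) i j i' j'
    · rw [List.tail_cons, List.tail_cons, hRi hu hzero, hidx0]
      omega
    · rw [List.tail_cons, List.tail_cons, hidxinj hu hzero, hidx0]
    · rw [List.tail_cons, List.tail_cons, hidxinj hv hzero, hidx0]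
    · have hP' := (hRi hu hv).1 hP
      rcases hb : a zero && !S
      -- The cut is in front of `zero`: on an edge of the cycle, `v` is `zero` exactly when `u` is
      -- the last point, whose number is `c`.
      · have hcN := hc2 (by simp [hb])
        have h1 := hidx hu
        have h2 := hidx hv
        rw [cond_false, beq_iff_eq, List.tail_cons, List.tail_cons, hidxinj hv hzero, hidx0]
        omega
      · rw [cond_true, Bool.and_eq_true, Bool.not_eq_true', ← Bool.not_eq_true, List.tail_cons,
          List.tail_cons, List.tail_cons, List.tail_cons, ha u hu, ha v hv, ← hA' hu, ← hA' hv]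
        exact hc3 hb _ (hlt hu) _ (hlt hv) hP'
  · obtain ⟨w, hw⟩ := Set.nonempty_of_ncard_ne_zero h0
    obtain ⟨s, hs, t, ht, hst⟩ := hc4 ⟨_, hlt (hA hw), w, hw, rfl⟩
    -- `exists_cut` gives the ends of the interval as positions; by surjectivity they belong to
    -- strings.
    have hs' : ∀ k < 4 * N, ∃ W ∈ strs (n + 2), pos W = k := fun k hk => by
      obtain ⟨W, hW, e⟩ := hbij.surjOn (length_bits (n + 2) k)
      refine ⟨W, hW, ?_⟩
      rw [← hval W hW, e, val_bits (by rwa [hN])]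
    obtain ⟨L, hL, rfl⟩ := hs' s hs
    obtain ⟨U, hU, rfl⟩ := hs' t ht
    refine ⟨L, hL, U, hU, Set.ext fun W => ?_⟩
    rw [Set.mem_ofPred_eq, lexLE_iff ((hlen' L).trans (hlen' W).symm),
      lexLE_iff ((hlen' W).trans (hlen' U).symm), hval L hL, hval U hU]
    constructor
    · rintro ⟨_, ⟨u, hu, rfl⟩, rfl⟩
      have hW : false :: false :: u ∈ strs (n + 2) := 
        mem_strs.2 (congrArg (· + 2) (mem_strs.1 (hA hu)))
      rw [hval _ hW]
      exact ⟨hW, (hst _ (hlt (hA hu)) false false).2 ⟨rfl, rfl, (hA' (hA hu)).2 hu⟩⟩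
    · rintro ⟨hW, h1⟩
      rw [hval _ hW] at h1
      obtain ⟨i, j, u, hu, rfl⟩ := exists_tags hW
      obtain ⟨rfl, rfl, hu'⟩ := (hst _ (hlt hu) i j).1 h1
      exact ⟨_, ⟨u, (hA' hu).1 hu', rfl⟩, rfl⟩

end ClusterComputing

namespace ClusterComputing

open Turing Function Computability

/-! ### The path is polynomial-time computable, and the reverse inclusion -/

section Combinators

variable {α A : Type} {ea : α → List A} [Fintype A]

theorem PolyFn.tagNext {P Q E R Zu Zv B bd i j i' j' : α → Bool}
    (hP : PolyFn ea encodeBool P) (hQ : PolyFn ea encodeBool Q) (hE : PolyFn ea encodeBool E)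
    (hR : PolyFn ea encodeBool R) (hZu : PolyFn ea encodeBool Zu)
    (hZv : PolyFn ea encodeBool Zv) (hB : PolyFn ea encodeBool B)
    (hbd : PolyFn ea encodeBool bd) (hi : PolyFn ea encodeBool i)
    (hj : PolyFn ea encodeBool j) (hi' : PolyFn ea encodeBool i')
    (hj' : PolyFn ea encodeBool j') :
    PolyFn ea encodeBool fun a => tagNext (P a) (Q a) (E a) (R a) (Zu a) (Zv a) (B a) (bd a)
      (i a) (j a) (i' a) (j' a) :=
  PolyFn.boolFn (m := 12) (f := ![P, Q, E, R, Zu, Zv, B, bd, i, j, i', j'])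
    (fun v => ClusterComputing.tagNext (v 0) (v 1) (v 2) (v 3) (v 4) (v 5) (v 6) (v 7) (v 8)
      (v 9) (v 10) (v 11))
    (by simp [Fin.forall_fin_succ, *])

theorem PolyFn.nextStr {R : α → Str → Str → Bool} {a : α → Str → Bool} {S : α → Bool}
    {zero Y Z : α → Str}
    (hR : ∀ {f g : α → Str}, PolyFn ea encStr f → PolyFn ea encStr g →
      PolyFn ea encodeBool fun t => R t (f t) (g t))
    (ha : ∀ {f : α → Str}, PolyFn ea encStr f → PolyFn ea encodeBool fun t => a t (f t))
    (hS : PolyFn ea encodeBool S) (hzero : PolyFn ea encStr zero) (hY : PolyFn ea encStr Y)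
    (hZ : PolyFn ea encStr Z) :
    PolyFn ea encodeBool fun t => nextStr (R t) (a t) (S t) (zero t) (Y t) (Z t) := by
  have hu := hY.tail.tail
  have hv := hZ.tail.tail
  have hB := (ha hzero).bool₂ (fun x y => x && !y) hS
  refine .tagNext (hR hu hv) (hR hv hu) (hu.beq hv) (hR hu hzero) (hu.beq hzero) (hv.beq hzero)
    hB ?_ hY.head hY.tail.head hZ.head hZ.tail.head
  -- The case distinction on the kind of cut, written with connectives.
  convert (hB.bool₂ and ((ha hu).bool₂ (fun x y => x && !y) (ha hv))).bool₂ or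
    (hB.bool₂ (fun x y => !x && y) (hv.beq hzero)) using 2 with t
  cases a t (zero t) && !S t <;> simp

end Combinators

open Classical in
theorem InP.exists_polyFn {L : Set Str} (hL : InP L) :
    ∃ g : Str → Bool, PolyFn encStr encodeBool g ∧ ∀ x, g x = true ↔ x ∈ L :=
  ⟨fun x => decide (x ∈ L), hL, fun _ => decide_eq_true_iff⟩

-- The path of `exists_path` begins at `01 zero` and ends at `10 zero`, both computable from `x`.
-- Padding twice moves the accepting set into copy 00.
open Classical in
theorem tildeCLUSharpPCircular_subset : TildeCLUSharpPCircular ⊆ CLUSharpP := by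
  rintro f ⟨p, M, prec, ⟨hM, hbal, hprec, H⟩, hS⟩
  obtain ⟨out, hout, hacc, hzero⟩ := M.exists_simulation hM hbal
  -- The string `0^n`, read off from the simulation without guesses; the tail drops the acceptance
  -- bit.
  let zero : Str → Str := fun x => (out (x, [])).tail
  obtain ⟨S, hS', hSf⟩ := hS.exists_polyFn
  have hz : PolyFn encStr encStr zero := (hout.comp (PolyFn.id.pair .nil)).tail
  have hx : PolyFn (encPair encStr (encPair encStr encStr)) encStr
      (fun t : Str × Str × Str => t.1) := .fst
  have hy : PolyFn (encPair encStr (encPair encStr encStr)) encStr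
      (fun t : Str × Str × Str => t.2.1) := PolyFn.fst.comp .snd
  have hz' : PolyFn (encPair encStr (encPair encStr encStr)) encStr
      (fun t : Str × Str × Str => t.2.2) := PolyFn.snd.comp .snd
  refine ⟨p + 1 + 1, M.pad.pad, fun x => false :: true :: zero x,
    fun x => true :: false :: zero x,
    fun x Y Z => nextStr (fun u v => decide (prec x u v)) (fun w => (out (x, w)).headD false)
      (S x) (zero x) Y Z = true, hM.pad.pad, hbal.pad.pad, (hz.cons true).cons false,
    (hz.cons false).cons true, ?_, fun x => ?_⟩
  · exact polyTimePred₃_of_polyFn (.nextStr (R := fun t u v => decide (prec t.1 u v))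
      (a := fun t w => (out (t.1, w)).headD false) (fun hf hg => hprec.polyFn hx hf hg) (fun hf => (hout.comp (hx.pair hf)).head) (hS'.comp hx) (hz.comp hx) hy hz')
      fun _ _ _ => Iff.rfl
  · obtain ⟨h, hh, hs, hc, hf⟩ := H x
    have hzx : zero x ∈ strs (p.eval x.length) := by
      rw [mem_strs, show zero x = _ from hzero x, List.length_replicate]
    obtain ⟨h', hh', h1, h2, h3, h4⟩ := exists_path hh hzx (NTM.acc_subset hbal x)
      (hf ▸ hc) (R := fun u v => decide (prec x u v))
      (fun y hy z hz => by rw [decide_eq_true_iff, hs y hy z hz])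
      (a := fun w => (out (x, w)).headD false) (hacc x) (S := S x)
      (by rw [hSf, Set.mem_ofPred_eq, hf])
    have e : (p + 1 + 1).eval x.length = p.eval x.length + 2 := by simp
    have hcons : ∀ b : Bool, Injective (List.cons b) := fun b => List.cons_injective
    rw [e, NTM.acc_pad, NTM.acc_pad, Set.ncard_image_of_injective _ (hcons _),
      Set.ncard_image_of_injective _ (hcons _), ← hf]
    have hl := mem_strs.1 hzx
    exact ⟨h', hh', by simp [hl], by simp [hl], h1, h2, h3, hf ▸ h4, rfl⟩

end ClusterComputing

theorem theoremt :
    ClusterComputing.TildeCLUSharpPCircular = ClusterComputing.CLUSharpP :=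
  ClusterComputing.tildeCLUSharpPCircular_subset.antisymm ClusterComputing.CLUSharpP_subset
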